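/- Theorem 1 (weak state space collapse for Adaptive MaxWeight). Model. Let $n\ge 1$. An $n\times n$ input-queued switch operates in slotted time. Let $\mathcal S$ be the set of schedules, i.e. of matrices $s\in\{0,1\}^{n\times n}$ all of whose row sums and column sums are at most $1$, and let $\Delta_r\ge 1$ be an integer (the reconfiguration delay). Its state is $X(t)=(q(t),s(t),r(t))\in\mathbb N^{n\times n}\times\mathcal S\times\{0,\dots,\Delta_r\}$: queue lengths, current schedule and remaining reconfiguration time. The arrival matrices $a(t)\in\mathbb N^{n\times n}$ are i.i.d. over $t$, independent over the queues $(i,j)$, and $a_{ij}(t)\le a_{\max}$. The queues evolve by $$q_{ij}(t+1)=\big[q_{ij}(t)+a_{ij}(t)-s_{ij}(t)\mathbf 1_{\{r(t)=0\}}\big]^+ .$$ Let $g:[0,\infty)\to[0,\infty)$ (the hysteresis function) be increasing, concave and sublinear ($g(x)/x\to0$ as $x\to\infty$), with $g(x)\to\infty$ as $x\to\infty$. Under Adaptive MaxWeight, let $W(t)=\sum_{ij}q_{ij}(t)s_{ij}(t)$, let $s^*(t)\in\mathcal S$ maximize $\sum_{ij}q_{ij}(t)s_{ij}$ over $s\in\mathcal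 S$ (ties broken by any fixed function of the state), and let $W^*(t)$ be that maximum. If $W^*(t)-W(t)>g(W^*(t))$, then $s(t+1)=s^*(t)$ and $r(t+1)=\Delta_r$; otherwise $s(t+1)=s(t)$ and $r(t+1)=\max\{r(t)-1,0\}$. Let $\|\cdot\|$ be the Euclidean norm on $\mathbb R^{n^2}$, let $\mathcal K=\{x: x_{ij}=w_i+\tilde w_j \text{ for all } i,j, \text{ for some } w,\tilde w\in[0,\infty)^n\}$, let $x_\parallel$ be the point of $\mathcal K$ nearest to $x$, and let $x_\perp=x-x_\parallel$. Fix $n,\Delta_r,g$, and consider switches as above with rate matrix $\mathbb E[a(t)]=(1-\epsilon)\nu$, where $0<\epsilon<1$, all row sums and column sums of $\nu$ equal $1$, and $\nu_{\min}=\min_{ij}\nu_{ij}>0$, and with $\sum_{ij}\mathrm{Var}(a_{ij}(t))\le\tilde\sigma^2$, where $a_{\max}$ and $\tilde\sigma$ do not depend on $\epsilon$. (1) For every $0<\epsilon<1$ the Markov chain $X(t)$ has a stationary distribution, and $\mathbb E\|\bar q\|<\infty$ whenever $\bar X=(\bar q,\bar s,\bar r)$ has a stationary distribution as its law. (2) For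 every $0<\theta<1/2$ there is a constant $M_\theta$, which depends only on $\theta,\tilde\sigma,a_{\max},\nu_{\min},n$ and on the fixed $\Delta_r,g$, and not on $\epsilon$, such that whenever $0<\epsilon\le \nu_{\min}/(4\|\nu\|)$ and $\bar X^{(\epsilon)}$ is in steady state, $$\mathbb E\big[\|\bar q^{(\epsilon)}_\perp\|-\theta\|\bar q^{(\epsilon)}_\parallel\|\big]\le M_\theta .$$ (3) For fixed $\nu$ and any family of such switches indexed by $0<\epsilon<1$, in steady state, $\mathbb E\|\bar q^{(\epsilon)}_\perp\|/\mathbb E\|\bar q^{(\epsilon)}\|\to0$ as $\epsilon\to0$ (a quotient $0/0$, which can occur only for $n=1$, is read as $0$); moreover $\mathbb E\|\bar q^{(\epsilon)}\|\to\infty$ if $n\ge2$. -/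

import Mathlib

open MeasureTheory ProbabilityTheory Filter Topology

noncomputable section

namespace AdaptiveMaxWeight

/-! ### Schedules and states of the switch -/

/-- A feasible schedule of the `n × n` switch: every input port and every output port is used at
most once. (All entries are then `0` or `1`.) -/
def Schedule (n : ℕ) : Type :=
  {s : Fin n → Fin n → ℕ // (∀ j, ∑ i, s i j ≤ 1) ∧ (∀ i, ∑ j, s i j ≤ 1)}

/-- A state `(q, s, r)` of the switch with reconfiguration delay `Δ`: the queue lengths, the
current schedule, and the remaining reconfiguration time. -/
structure State (n Δ : ℕ) where
  /-- queue lengths -/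
  q : Fin n → Fin n → ℕ
  /-- current schedule -/
  s : Schedule n
  /-- remaining reconfiguration time, `0` if the switch is not being reconfigured -/
  r : Fin (Δ + 1)

/-- The state space is countable and carries the discrete σ-algebra. -/
instance instMeasurableSpaceState (n Δ : ℕ) : MeasurableSpace (State n Δ) := ⊤

/-- The weight `∑ q_ij s_ij` of a schedule. -/
def weight {n : ℕ} (q : Fin n → Fin n → ℕ) (s : Schedule n) : ℕ :=
  ∑ i, ∑ j, q i j * s.1 i j

/-! ### The Adaptive MaxWeight policy -/

/-- Hysteresis functions `g : [0, ∞) → [0, ∞)` (values of `g` at negative numbers are irrelevant):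
increasing, concave, sublinear and unbounded. -/
structure IsHysteresis (g : ℝ → ℝ) : Prop where
  nonneg : ∀ x, 0 ≤ x → 0 ≤ g x
  mono : MonotoneOn g (Set.Ici 0)
  concave : ConcaveOn ℝ (Set.Ici 0) g
  sublinear : Tendsto (fun x => g x / x) atTop (𝓝 0)
  unbounded : Tendsto g atTop atTop

/-- A switch: the law of the number of arrivals to each queue in one time slot, and a choice of a
schedule of maximum weight (that is, a rule for breaking ties in the arg max). -/
structure Switch (n Δ : ℕ) where
  /-- law of the number of arrivals to queue `(i, j)` in one time slot -/
  arrival : Fin n → Fin n → PMF ℕ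
  /-- the MaxWeight schedule that is selected in each state -/
  maxSched : State n Δ → Schedule n
  maxSched_max : ∀ (x : State n Δ) (s : Schedule n), weight x.q s ≤ weight x.q (maxSched x)

variable {n Δ : ℕ}

/-- The switch is reconfigured at the next time slot: `W* - W > g(W*)`. -/
def Switch.Reconfigures (S : Switch n Δ) (g : ℝ → ℝ) (x : State n Δ) : Prop :=
  (weight x.q (S.maxSched x) : ℝ) - (weight x.q x.s : ℝ) > g (weight x.q (S.maxSched x) : ℝ)

open Classical in
/-- One time slot under Adaptive MaxWeight with arrivals `a`. Queue lengths evolve by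
`q ↦ [q + a - s 1_{r = 0}]^+` (the subtraction of natural numbers is truncated at `0`). If the
weight difference exceeds the threshold, the schedule becomes the MaxWeight schedule and a
reconfiguration delay of `Δ` slots begins; otherwise the schedule is kept and the remaining
reconfiguration time, if positive, decreases by one. -/
def Switch.step (S : Switch n Δ) (g : ℝ → ℝ) (x : State n Δ) (a : Fin n → Fin n → ℕ) :
    State n Δ where
  q := fun i j => x.q i j + a i j - (if (x.r : ℕ) = 0 then x.s.1 i j else 0)
  s := if S.Reconfigures g x then S.maxSched x else x.s
  r := if S.Reconfigures g x then Fin.last Δ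
    else ⟨(x.r : ℕ) - 1, lt_of_le_of_lt (Nat.sub_le _ _) x.r.isLt⟩

/-- The law of the arrival matrix of one time slot; the queues are independent. -/
def Switch.arrivalLaw (S : Switch n Δ) : Measure (Fin n → Fin n → ℕ) :=
  Measure.pi fun i => Measure.pi fun j => (S.arrival i j).toMeasure

/-- The transition kernel of the Markov chain `X(t) = (q(t), s(t), r(t))` under Adaptive MaxWeight
with hysteresis function `g`; the arrivals are i.i.d. over the time slots. -/
def Switch.transition (S : Switch n Δ) (g : ℝ → ℝ) : Kernel (State n Δ) (State n Δ) where
  toFun x := S.arrivalLaw.map (S.step g x)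
  measurable' := measurable_from_top

/-- `π` is a steady state (stationary) distribution of the Markov chain `X(t)`. -/
structure Switch.IsSteadyState (S : Switch n Δ) (g : ℝ → ℝ) (π : Measure (State n Δ)) : Prop where
  isProbabilityMeasure : IsProbabilityMeasure π
  invariant : Kernel.Invariant (S.transition g) π

/-! ### Euclidean geometry of queue vectors -/

/-- An `n × n` matrix as a vector of the Euclidean space `ℝ^(n²)`. -/
def vec (A : Fin n → Fin n → ℝ) : EuclideanSpace ℝ (Fin n × Fin n) :=
  WithLp.toLp 2 fun p => A p.1 p.2

/-- The cone `𝒦` spanned by the indicator matrices of the rows and of the columns. -/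
def cone (n : ℕ) : Set (EuclideanSpace ℝ (Fin n × Fin n)) :=
  {x | ∃ w v : Fin n → ℝ, (∀ i, 0 ≤ w i) ∧ (∀ j, 0 ≤ v j) ∧ ∀ i j, x (i, j) = w i + v j}

theorem mem_cone_iff (x : EuclideanSpace ℝ (Fin n × Fin n)) :
    x ∈ cone n ↔ (∀ p, 0 ≤ x p) ∧
      ∀ i j i' j', x (i, j) + x (i', j') = x (i, j') + x (i', j) := by
  constructor
  · rintro ⟨w, v, hw, hv, h⟩
    refine ⟨fun p => ?_, fun i j i' j' => ?_⟩
    · have := h p.1 p.2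
      rw [Prod.mk.eta] at this
      rw [this]
      exact add_nonneg (hw _) (hv _)
    · rw [h, h, h, h]; ring
  · rintro ⟨h0, h⟩
    rcases isEmpty_or_nonempty (Fin n) with he | hne
    · exact ⟨0, 0, fun i => he.elim i, fun i => he.elim i, fun i => he.elim i⟩
    · let j0 : Fin n := hne.some
      obtain ⟨i0, hi0⟩ := Finite.exists_min (fun i => x (i, j0))
      refine ⟨fun i => x (i, j0) - x (i0, j0), fun j => x (i0, j), fun i => ?_,
        fun j => h0 _, fun i j => ?_⟩
      · exact sub_nonneg.2 (hi0 i)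
      · have := h i j i0 j0
        linarith

theorem cone_nonempty (n : ℕ) : (cone n).Nonempty :=
  ⟨0, 0, 0, fun _ => le_rfl, fun _ => le_rfl, fun i j => by simp⟩

theorem cone_convex (n : ℕ) : Convex ℝ (cone n) := by
  rintro x ⟨w, v, hw, hv, h⟩ y ⟨w', v', hw', hv', h'⟩ a b ha hb _
  refine ⟨fun i => a * w i + b * w' i, fun j => a * v j + b * v' j, fun i => ?_, fun j => ?_,
    fun i j => ?_⟩
  · exact add_nonneg (mul_nonneg ha (hw i)) (mul_nonneg hb (hw' i))
  · exact add_nonneg (mul_nonneg ha (hv j)) (mul_nonneg hb (hv' j))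
  · simp [h, h']; ring

theorem cone_isClosed (n : ℕ) : IsClosed (cone n) := by
  have : cone n = (⋂ p, {x : EuclideanSpace ℝ (Fin n × Fin n) | 0 ≤ x p}) ∩
      ⋂ i, ⋂ j, ⋂ i', ⋂ j', {x : EuclideanSpace ℝ (Fin n × Fin n) |
        x (i, j) + x (i', j') = x (i, j') + x (i', j)} := by
    ext x
    simp only [mem_cone_iff, Set.mem_inter_iff, Set.mem_iInter, Set.mem_ofPred_eq]
  rw [this]
  refine IsClosed.inter (isClosed_iInter fun p => isClosed_le (by fun_prop) (by fun_prop)) ?_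
  exact isClosed_iInter fun i => isClosed_iInter fun j => isClosed_iInter fun i' =>
    isClosed_iInter fun j' => isClosed_eq (by fun_prop) (by fun_prop)

/-- The nearest point of the cone exists and is unique. -/
theorem existsUnique_nearest (x : EuclideanSpace ℝ (Fin n × Fin n)) :
    ∃! y, y ∈ cone n ∧ ∀ z ∈ cone n, ‖x - y‖ ≤ ‖x - z‖ := by
  have key : ∀ y ∈ cone n, (∀ z ∈ cone n, ‖x - y‖ ≤ ‖x - z‖) →
      ∀ z ∈ cone n, inner ℝ (x - y) (z - y) ≤ 0 := by
    intro y hy hmin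
    refine (norm_eq_iInf_iff_real_inner_le_zero (cone_convex n) hy).1 ?_
    have : Nonempty (cone n) := ⟨⟨y, hy⟩⟩
    refine le_antisymm (le_ciInf fun z => hmin z z.2) ?_
    exact ciInf_le (f := fun z : cone n => ‖x - z‖)
      ⟨0, by rintro _ ⟨z, rfl⟩; exact norm_nonneg _⟩ ⟨y, hy⟩
  obtain ⟨y, hy, hd⟩ := (cone_isClosed n).exists_infDist_eq_dist (cone_nonempty n) x
  refine ⟨y, ⟨hy, fun z hz => ?_⟩, ?_⟩
  · rw [← dist_eq_norm, ← dist_eq_norm, ← hd]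
    exact Metric.infDist_le_dist_of_mem hz
  · rintro z ⟨hz, hzmin⟩
    have h1 := key z hz hzmin y hy
    have h2 := key y hy (fun w hw => by
      rw [← dist_eq_norm, ← dist_eq_norm, ← hd]
      exact Metric.infDist_le_dist_of_mem hw) z hz
    have h3 : inner ℝ (x - z) (y - z) + inner ℝ (x - y) (z - y) = ‖y - z‖ ^ 2 := by
      rw [← real_inner_self_eq_norm_sq, ← neg_sub y z, inner_neg_right, ← sub_eq_add_neg,
        ← inner_sub_left]
      congr 1
      abel
    have h4 : ‖y - z‖ = 0 := by nlinarith [norm_nonneg (y - z)]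
    exact (sub_eq_zero.1 (norm_eq_zero.1 h4)).symm

/-- `x_∥`: the projection of `x` onto the cone, the minimizer of `‖x - y‖` over `y` in the cone. -/
def par (x : EuclideanSpace ℝ (Fin n × Fin n)) : EuclideanSpace ℝ (Fin n × Fin n) :=
  Classical.choose (existsUnique_nearest x).exists

/-- `x_⊥ = x - x_∥`. -/
def perp (x : EuclideanSpace ℝ (Fin n × Fin n)) : EuclideanSpace ℝ (Fin n × Fin n) :=
  x - par x

/-- The queue lengths of a state as a vector of `ℝ^(n²)`. -/
def State.qvec (x : State n Δ) : EuclideanSpace ℝ (Fin n × Fin n) :=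
  vec fun i j => (x.q i j : ℝ)

/-! ### Arrival rates -/

/-- The rate matrix `ν` lies in the face `ℱ` on which all ports are saturated, and its smallest
entry is `m`. -/
structure IsSaturated (ν : Fin n → Fin n → ℝ) (m : ℝ) : Prop where
  col_sum : ∀ j, ∑ i, ν i j = 1
  row_sum : ∀ i, ∑ j, ν i j = 1
  isLeast : IsLeast (Set.range fun p : Fin n × Fin n => ν p.1 p.2) m

/-- The arrivals are bounded by `amax`, have rate matrix `(1 - ε) ν`, and their variances satisfy
`‖σ‖² = ∑ σ_ij² ≤ σ̃²`. -/
structure Switch.HasTraffic (S : Switch n Δ) (amax : ℕ) (σ : ℝ) (ν : Fin n → Fin n → ℝ) (ε : ℝ) :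
    Prop where
  bounded : ∀ i j, ∀ k ∈ (S.arrival i j).support, k ≤ amax
  mean : ∀ i j, ∫ k, (k : ℝ) ∂(S.arrival i j).toMeasure = (1 - ε) * ν i j
  variance : ∑ i, ∑ j, ProbabilityTheory.variance (fun k : ℕ => (k : ℝ)) (S.arrival i j).toMeasure
    ≤ σ ^ 2

end AdaptiveMaxWeight

end

/-! Write W* for the maximum weight. For p with nonnegative entries, ‖q - p‖² changes in one slot by
at most 2⟨q - p, a - service⟩ plus a constant. Two facts about the cone make this useful. The vector
q_⊥ lies in the polar cone, so its row and column sums are nonpositive and ν + m q_⊥/‖q_⊥‖ is doubly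
substochastic; Birkhoff–von Neumann then gives ⟨q, ν⟩ + m‖q_⊥‖ ≤ W*
(`Switch.inner_add_le_weight_maxSched`). And against q_∥ no schedule beats ν. Hence, if W* were
served in every slot, ‖q_⊥‖² would have drift of order -m‖q_⊥‖, and ‖q‖² drift of order -εm times
the total queue length.

The obstacle is the lost weight: W* minus the weight served, which is all of W* during a
reconfiguration. It is paid for by a nonnegative potential Ψ (`exists_compensator`). A
reconfiguration costs about Δ W*, and W* times the remaining time spreads this cost over its slots.
Reconfigurations are rare: the gap W* - W rises by O(1) per slot and must exceed g(W*), which is at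
least any prescribed K once W* is large. So W* min(W* - W, K) pays about K W* at each
reconfiguration and collects O(W*) per slot. With K large, the lost weight costs only η W* + c,
where c is uniform over the switches.

Adding Ψ to ‖q‖² yields existence of a steady state and integrability through Foster's criterion.
Adding Ψ to ‖q_⊥‖² and splitting η W* between q_∥ and q_⊥ yields the collapse inequality. Stationary
means come from `lintegral_le_of_drift`, which does not require a finite mean of the Lyapunov
function.

For the ratio it remains to show that the mean queue length diverges when n ≥ 2. Balance of one row
shows that the switch reconfigures for a fraction at most ε of the time, hence starts
reconfigurations with frequency at most ε. Between starts the unscheduled queues grow at a rate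
independent of ε, so they are below any fixed level L with probability O(ε). -/

noncomputable section

/-! ### Countable-type Markov chains: drift bounds for stationary means, Foster's criterion -/

section MarkovChains

open scoped ENNReal

variable {α : Type*} [MeasurableSpace α] [DiscreteMeasurableSpace α]

/-- Expectations of functions of the current state and of the next state agree under an invariant
measure. -/
theorem ProbabilityTheory.Kernel.Invariant.lintegral_lintegral {κ : Kernel α α} {π : Measure α}
    (h : Kernel.Invariant κ π) (f : α → ℝ≥0∞) : ∫⁻ x, ∫⁻ y, f y ∂κ x ∂π = ∫⁻ x, f x ∂π := by
  have h1 := Measure.lintegral_bind (m := π) (μ := κ) (f := f) κ.measurable.aemeasurable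
    Measurable.of_discrete.aemeasurable
  rw [← h1]
  congr 1

/-- The iterated form of a drift condition. -/
theorem sum_iterate_add_le_of_drift {κ : Kernel α α} {V f h : α → ℝ≥0∞}
    (hd : ∀ x, ∫⁻ y, V y ∂κ x + f x ≤ V x + h x) (N : ℕ) (x : α) :
    ∑ k ∈ Finset.range N, ((fun (u : α → ℝ≥0∞) x => ∫⁻ y, u y ∂κ x)^[k]) f x
      + ((fun (u : α → ℝ≥0∞) x => ∫⁻ y, u y ∂κ x)^[N]) V x
    ≤ V x + ∑ k ∈ Finset.range N, ((fun (u : α → ℝ≥0∞) x => ∫⁻ y, u y ∂κ x)^[k]) h x := by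
  induction N generalizing x with
  | zero => simp
  | succ N ih =>
    have h1 := lintegral_mono (μ := κ x) ih
    rw [lintegral_add_left Measurable.of_discrete, lintegral_add_left Measurable.of_discrete,
      lintegral_finsetSum _ (fun _ _ => Measurable.of_discrete),
      lintegral_finsetSum _ (fun _ _ => Measurable.of_discrete)] at h1
    rw [Finset.sum_range_succ', Finset.sum_range_succ']
    simp only [Function.iterate_succ_apply', Function.iterate_zero, id]
    calc _ = (∑ k ∈ Finset.range N, ∫⁻ y, ((fun (u : α → ℝ≥0∞) x => ∫⁻ y, u y ∂κ x)^[k]) f y ∂κ x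
          + ∫⁻ y, ((fun (u : α → ℝ≥0∞) x => ∫⁻ y, u y ∂κ x)^[N]) V y ∂κ x) + f x := by ring
      _ ≤ (∫⁻ y, V y ∂κ x
          + ∑ k ∈ Finset.range N, ∫⁻ y, ((fun (u : α → ℝ≥0∞) x => ∫⁻ y, u y ∂κ x)^[k]) h y ∂κ x)
          + f x := by gcongr
      _ = (∫⁻ y, V y ∂κ x + f x)
          + ∑ k ∈ Finset.range N, ∫⁻ y, ((fun (u : α → ℝ≥0∞) x => ∫⁻ y, u y ∂κ x)^[k]) h y ∂κ x := by
        ring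
      _ ≤ (V x + h x)
          + ∑ k ∈ Finset.range N, ∫⁻ y, ((fun (u : α → ℝ≥0∞) x => ∫⁻ y, u y ∂κ x)^[k]) h y ∂κ x := by
        exact add_le_add_left (hd x) _
      _ = _ := by ring

theorem ProbabilityTheory.Kernel.Invariant.lintegral_iterate {κ : Kernel α α} {π : Measure α}
    (hπ : Kernel.Invariant κ π) (f : α → ℝ≥0∞) (k : ℕ) :
    ∫⁻ x, ((fun (u : α → ℝ≥0∞) x => ∫⁻ y, u y ∂κ x)^[k]) f x ∂π = ∫⁻ x, f x ∂π := by
  induction k with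
  | zero => rfl
  | succ k ih => simp only [Function.iterate_succ_apply']; rw [hπ.lintegral_lintegral, ih]

/-- A drift condition `PV + f ≤ V + h` bounds the stationary mean of `f` by that of `h`, although
the stationary mean of `V` may be infinite. -/
theorem lintegral_le_of_drift {κ : Kernel α α} [IsMarkovKernel κ] {π : Measure α}
    [IsProbabilityMeasure π] (hπ : Kernel.Invariant κ π) {V f h : α → ℝ≥0∞} (hV : ∀ x, V x ≠ ∞)
    (hd : ∀ x, ∫⁻ y, V y ∂κ x + f x ≤ V x + h x) : ∫⁻ x, f x ∂π ≤ ∫⁻ x, h x ∂π := by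
  -- V may have infinite mean, so it cannot be cancelled after integration. Capping f at L caps a
  -- sum of N + 1 terms at (N + 1)L; hence only min(V, (N + 1)L) is needed on the right. Divided by
  -- N + 1, this vanishes in the limit by dominated convergence.
  have trunc : ∀ (L N : ℕ), ∫⁻ x, min (f x) L ∂π
      ≤ ∫⁻ x, min (V x / (N + 1 : ℕ)) L ∂π + ∫⁻ x, h x ∂π := by
    intro L N
    have hit : ∀ (k : ℕ) (x : α), ((fun (u : α → ℝ≥0∞) x => ∫⁻ y, u y ∂κ x)^[k])
        (fun x => min (f x) L) x ≤ L := by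
      intro k
      induction k with
      | zero => exact fun x => min_le_right _ _
      | succ k ih =>
        intro x
        rw [Function.iterate_succ_apply']
        exact (lintegral_mono ih).trans (by simp)
    have h1 : ∀ x, ∑ k ∈ Finset.range (N + 1), ((fun (u : α → ℝ≥0∞) x => ∫⁻ y, u y ∂κ x)^[k])
        (fun x => min (f x) L) x ≤ min (V x) ((N + 1 : ℕ) * L)
        + ∑ k ∈ Finset.range (N + 1), ((fun (u : α → ℝ≥0∞) x => ∫⁻ y, u y ∂κ x)^[k]) h x := by
      intro x
      rw [min_add, le_min_iff]
      constructor
      · refine le_trans ?_ (sum_iterate_add_le_of_drift (f := fun x => min (f x) L)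
          (fun x => le_trans ?_ (hd x)) (N + 1) x)
        · exact le_self_add
        · gcongr; exact min_le_left _ _
      · refine le_trans (Finset.sum_le_sum fun k _ => hit k x) ?_
        simp
    have h2 := lintegral_mono (μ := π) h1
    rw [lintegral_add_left Measurable.of_discrete,
      lintegral_finsetSum _ (fun _ _ => Measurable.of_discrete),
      lintegral_finsetSum _ (fun _ _ => Measurable.of_discrete)] at h2
    simp only [hπ.lintegral_iterate, Finset.sum_const, Finset.card_range, nsmul_eq_mul] at h2
    have hN0 : ((N + 1 : ℕ) : ℝ≥0∞) ≠ 0 := by simp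
    have hNt : ((N + 1 : ℕ) : ℝ≥0∞) ≠ ∞ := ENNReal.natCast_ne_top _
    have h3 : ∫⁻ x, min (V x) ((N + 1 : ℕ) * L) ∂π
        = (N + 1 : ℕ) * ∫⁻ x, min (V x / (N + 1 : ℕ)) L ∂π := by
      rw [← lintegral_const_mul _ Measurable.of_discrete]
      refine lintegral_congr fun x => ?_
      rw [mul_min, ENNReal.mul_div_cancel hN0 hNt]
    rw [h3, ← mul_add] at h2
    exact (ENNReal.mul_le_mul_iff_right hN0 hNt).1 h2
  have lim : ∀ L : ℕ, ∫⁻ x, min (f x) L ∂π ≤ ∫⁻ x, h x ∂π := by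
    intro L
    have h1 : Tendsto (fun N : ℕ => ∫⁻ x, min (V x / (N + 1 : ℕ)) L ∂π) atTop
        (𝓝 (∫⁻ _, 0 ∂π)) := by
      refine tendsto_lintegral_of_dominated_convergence (fun _ => (L : ℝ≥0∞))
        (fun _ => Measurable.of_discrete) (fun N => ae_of_all _ fun x => min_le_right _ _)
        (by simp) (ae_of_all _ fun x => ?_)
      have h2 : Tendsto (fun N : ℕ => V x / (N + 1 : ℕ)) atTop (𝓝 0) := by
        have h3 := ENNReal.Tendsto.const_div (a := V x)
          ((ENNReal.tendsto_nat_nhds_top).comp (tendsto_add_atTop_nat 1)) (Or.inr (hV x))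
        simpa using h3
      have h4 := h2.min (tendsto_const_nhds (x := (L : ℝ≥0∞)))
      simpa using h4
    have h5 := h1.add_const (∫⁻ x, h x ∂π)
    simp only [lintegral_zero, zero_add] at h5
    exact ge_of_tendsto' h5 (trunc L)
  have hsup : ∀ x, f x = ⨆ L : ℕ, min (f x) L := by
    intro x
    refine le_antisymm ?_ (iSup_le fun L => min_le_left _ _)
    have h1 : Tendsto (fun L : ℕ => min (f x) (L : ℝ≥0∞)) atTop (𝓝 (f x)) := by
      have := (tendsto_const_nhds (x := f x)).min ENNReal.tendsto_nat_nhds_top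
      simpa using this
    exact le_of_tendsto' h1 fun L => le_iSup (fun L : ℕ => min (f x) (L : ℝ≥0∞)) L
  rw [lintegral_congr hsup, lintegral_iSup (fun _ => Measurable.of_discrete)]
  · exact iSup_le lim
  · intro L L' hL x
    have : (L : ℝ≥0∞) ≤ L' := by exact_mod_cast hL
    exact min_le_min_left _ this

/-- A reverse drift condition `V + f ≤ PV + h` bounds the stationary mean of `f` by that of `h`
if the stationary mean of `V` is finite. -/
theorem lintegral_le_of_reverse_drift {κ : Kernel α α} {π : Measure α}
    (hπ : Kernel.Invariant κ π) {V f h : α → ℝ≥0∞} (hV : ∫⁻ x, V x ∂π ≠ ∞)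
    (hd : ∀ x, V x + f x ≤ ∫⁻ y, V y ∂κ x + h x) : ∫⁻ x, f x ∂π ≤ ∫⁻ x, h x ∂π := by
  have h1 := lintegral_mono (μ := π) hd
  rw [lintegral_add_left Measurable.of_discrete, lintegral_add_left Measurable.of_discrete,
    hπ.lintegral_lintegral] at h1
  exact (ENNReal.add_le_add_iff_left hV).1 h1

/-- The laws of a Markov chain started at `x₀`. -/
def markovLaw (κ : Kernel α α) (x₀ : α) : ℕ → Measure α
  | 0 => Measure.dirac x₀
  | k + 1 => (markovLaw κ x₀ k).bind κ

instance markovLaw.isProbabilityMeasure (κ : Kernel α α) [IsMarkovKernel κ] (x₀ : α) (k : ℕ) :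
    IsProbabilityMeasure (markovLaw κ x₀ k) := by
  induction k with
  | zero => exact Measure.dirac.isProbabilityMeasure
  | succ k ih =>
    constructor
    change ((markovLaw κ x₀ k).bind κ) Set.univ = 1
    rw [Measure.bind_apply MeasurableSet.univ κ.measurable.aemeasurable]
    simp

/-- The occupation measure of the first `N` states of a Markov chain started at `x₀`. -/
def occupation (κ : Kernel α α) (x₀ : α) (N : ℕ) (s : Set α) : ℝ≥0∞ :=
  (N : ℝ≥0∞)⁻¹ * ∑ k ∈ Finset.range N, markovLaw κ x₀ k s

theorem occupation_finset (κ : Kernel α α) (x₀ : α) (N : ℕ) (s : Finset α) :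
    occupation κ x₀ N s = ∑ x ∈ s, occupation κ x₀ N {x} := by
  simp only [occupation]
  rw [← Finset.mul_sum, Finset.sum_comm]
  congr 1
  refine Finset.sum_congr rfl fun k _ => ?_
  rw [sum_measure_singleton]

theorem occupation_le_one {β : Type*} [MeasurableSpace β] (κ : Kernel β β) [IsMarkovKernel κ]
    (x₀ : β) (N : ℕ) (s : Set β) :
    occupation κ x₀ N s ≤ 1 := by
  calc occupation κ x₀ N s ≤ (N : ℝ≥0∞)⁻¹ * ∑ k ∈ Finset.range N, 1 := by
        unfold occupation; gcongr; exact prob_le_one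
    _ = (N : ℝ≥0∞)⁻¹ * N := by simp
    _ ≤ 1 := ENNReal.inv_mul_le_one _

/-- Part of the mass that moves to x in one slot is at most the next law at x, and shifting a time
average by one slot raises it by at most 1/N. Limits of occupation measures are therefore
subinvariant. -/
theorem sum_occupation_mul_le (κ : Kernel α α) [IsMarkovKernel κ] (x₀ : α) (N : ℕ) (s : Finset α)
    (x : α) :
    ∑ y ∈ s, occupation κ x₀ N {y} * κ y {x} ≤ occupation κ x₀ N {x} + (N : ℝ≥0∞)⁻¹ := by
  have h1 : ∀ k, ∑ y ∈ s, markovLaw κ x₀ k {y} * κ y {x} ≤ markovLaw κ x₀ (k + 1) {x} := by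
    intro k
    change _ ≤ ((markovLaw κ x₀ k).bind κ) {x}
    rw [Measure.bind_apply (MeasurableSet.of_discrete) κ.measurable.aemeasurable]
    calc _ = ∑ y ∈ s, κ y {x} * markovLaw κ x₀ k {y} :=
          Finset.sum_congr rfl fun _ _ => mul_comm _ _
      _ = ∫⁻ y in s, κ y {x} ∂markovLaw κ x₀ k := (lintegral_finset _ _).symm
      _ ≤ _ := setLIntegral_le_lintegral _ _
  calc ∑ y ∈ s, occupation κ x₀ N {y} * κ y {x}
      = (N : ℝ≥0∞)⁻¹ * ∑ k ∈ Finset.range N, ∑ y ∈ s, markovLaw κ x₀ k {y} * κ y {x} := by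
        simp only [occupation]
        rw [Finset.sum_comm, Finset.mul_sum]
        refine Finset.sum_congr rfl fun y _ => ?_
        rw [mul_assoc, Finset.sum_mul]
    _ ≤ (N : ℝ≥0∞)⁻¹ * ∑ k ∈ Finset.range N, markovLaw κ x₀ (k + 1) {x} := by
        gcongr; exact h1 _
    _ ≤ (N : ℝ≥0∞)⁻¹ * (∑ k ∈ Finset.range N, markovLaw κ x₀ k {x} + 1) := by
        gcongr
        calc _ ≤ ∑ k ∈ Finset.range N, markovLaw κ x₀ (k + 1) {x} + markovLaw κ x₀ 0 {x} :=
              le_self_add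
          _ = ∑ k ∈ Finset.range (N + 1), markovLaw κ x₀ k {x} :=
              (Finset.sum_range_succ' (fun k => markovLaw κ x₀ k {x}) N).symm
          _ = ∑ k ∈ Finset.range N, markovLaw κ x₀ k {x} + markovLaw κ x₀ N {x} :=
              Finset.sum_range_succ (fun k => markovLaw κ x₀ k {x}) N
          _ ≤ _ := by gcongr; exact prob_le_one
    _ = _ := by rw [mul_add, mul_one]; rfl

/-- Foster's condition gives a lower bound for the occupation of the finite set. -/
theorem one_le_occupation_of_drift (κ : Kernel α α) [IsMarkovKernel κ] (x₀ : α) {V : α → ℝ≥0∞}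
    {F : Set α} {b : ℝ≥0∞}
    (hd : ∀ x, ∫⁻ y, V y ∂κ x + 1 ≤ V x + F.indicator (fun _ => b) x) (N : ℕ) (hN : N ≠ 0) :
    1 ≤ V x₀ / N + b * occupation κ x₀ N F := by
  have h1 : ∀ k, ∫⁻ x, V x ∂markovLaw κ x₀ (k + 1) + 1
      ≤ ∫⁻ x, V x ∂markovLaw κ x₀ k + b * markovLaw κ x₀ k F := by
    intro k
    have h2 := lintegral_mono (μ := markovLaw κ x₀ k) hd
    rw [lintegral_add_left Measurable.of_discrete, lintegral_add_left Measurable.of_discrete,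
      lintegral_indicator MeasurableSet.of_discrete, lintegral_const, lintegral_const] at h2
    simp only [measure_univ, mul_one, Measure.restrict_apply_univ] at h2
    refine le_trans (le_of_eq ?_) h2
    congr 1
    exact Measure.lintegral_bind κ.measurable.aemeasurable Measurable.of_discrete.aemeasurable
  have h3 : ∀ M : ℕ, ∫⁻ x, V x ∂markovLaw κ x₀ M + M
      ≤ V x₀ + b * ∑ k ∈ Finset.range M, markovLaw κ x₀ k F := by
    intro M
    induction M with
    | zero =>
      simp [markovLaw]
    | succ M ih =>
      calc _ = (∫⁻ x, V x ∂markovLaw κ x₀ (M + 1) + 1) + M := by push_cast; ring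
        _ ≤ (∫⁻ x, V x ∂markovLaw κ x₀ M + b * markovLaw κ x₀ M F) + M := by
          exact add_le_add_left (h1 M) _
        _ = (∫⁻ x, V x ∂markovLaw κ x₀ M + M) + b * markovLaw κ x₀ M F := by ring
        _ ≤ (V x₀ + b * ∑ k ∈ Finset.range M, markovLaw κ x₀ k F) + b * markovLaw κ x₀ M F := by
          gcongr
        _ = _ := by rw [Finset.sum_range_succ]; ring
  have hN0 : (N : ℝ≥0∞) ≠ 0 := by exact_mod_cast hN
  have hNt : (N : ℝ≥0∞) ≠ ∞ := ENNReal.natCast_ne_top _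
  calc (1 : ℝ≥0∞) = (N : ℝ≥0∞)⁻¹ * N := (ENNReal.inv_mul_cancel hN0 hNt).symm
    _ ≤ (N : ℝ≥0∞)⁻¹ * (V x₀ + b * ∑ k ∈ Finset.range N, markovLaw κ x₀ k F) := by
      gcongr; exact le_add_self.trans (h3 N)
    _ = _ := by unfold occupation; rw [ENNReal.div_eq_inv_mul]; ring

/-- Foster's criterion: a Markov chain on a countable space with negative drift outside a finite
set has an invariant probability measure. -/
theorem exists_invariant_of_drift [Countable α] (κ : Kernel α α) [IsMarkovKernel κ] (x₀ : α)
    {V : α → ℝ≥0∞} (hV : V x₀ ≠ ∞) (F : Finset α) {b : ℝ≥0∞} (hb : b ≠ ∞)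
    (hd : ∀ x, ∫⁻ y, V y ∂κ x + 1 ≤ V x + (F : Set α).indicator (fun _ => b) x) :
    ∃ π : Measure α, IsProbabilityMeasure π ∧ Kernel.Invariant κ π := by
  -- Along an ultrafilter all point occupations converge simultaneously in the compact space [0, ∞],
  -- so no diagonal subsequence is needed.
  let U : Ultrafilter ℕ := hyperfilter ℕ
  have hU : (U : Filter ℕ) ≤ atTop := by
    rw [← Nat.cofinite_eq_atTop]; exact hyperfilter_le_cofinite
  let w : α → ℝ≥0∞ := fun x => (U.map fun N => occupation κ x₀ N {x}).lim
  have hw : ∀ x, Tendsto (fun N => occupation κ x₀ N {x}) U (𝓝 (w x)) := fun x =>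
    (U.map fun N => occupation κ x₀ N {x}).le_nhds_lim
  have hinv : Tendsto (fun N : ℕ => (N : ℝ≥0∞)⁻¹) U (𝓝 0) :=
    ENNReal.tendsto_inv_nat_nhds_zero.mono_left hU
  have hsum : ∑' x, w x ≤ 1 := by
    refine ENNReal.tsum_eq_iSup_sum.trans_le (iSup_le fun s => ?_)
    refine le_of_tendsto' (tendsto_finsetSum s fun x _ => hw x) fun N => ?_
    rw [← occupation_finset]
    exact occupation_le_one _ _ _ _
  let μ : Measure α := Measure.sum fun x => w x • Measure.dirac x
  have hμs : ∀ x, μ {x} = w x := by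
    intro x
    simp only [μ]
    rw [Measure.sum_apply _ MeasurableSet.of_discrete, tsum_eq_single x]
    · simp
    · intro y hy
      simp [hy]
  have hμu : μ Set.univ = ∑' x, w x := by
    simp only [μ]
    rw [Measure.sum_apply _ MeasurableSet.univ]
    simp
  have hfin : IsFiniteMeasure μ := ⟨by rw [hμu]; exact hsum.trans_lt ENNReal.one_lt_top⟩
  have hbu : (μ.bind κ) Set.univ = μ Set.univ := by
    rw [Measure.bind_apply MeasurableSet.univ κ.measurable.aemeasurable]
    simp
  have hbfin : IsFiniteMeasure (μ.bind κ) := ⟨by rw [hbu]; exact measure_lt_top _ _⟩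
  -- Mass may escape to infinity in the limit, so only subinvariance is inherited. Since a Markov
  -- kernel preserves the finite total mass, it upgrades to equality.
  have hle : μ.bind κ ≤ μ := by
    have hpt : ∀ x, (μ.bind κ) {x} ≤ μ {x} := by
      intro x
      rw [Measure.bind_apply MeasurableSet.of_discrete κ.measurable.aemeasurable,
        lintegral_countable']
      refine ENNReal.tsum_eq_iSup_sum.trans_le (iSup_le fun s => ?_)
      have h1 : Tendsto (fun N => ∑ y ∈ s, occupation κ x₀ N {y} * κ y {x}) U
          (𝓝 (∑ y ∈ s, w y * κ y {x})) :=
        tendsto_finsetSum s fun y _ => ENNReal.Tendsto.mul_const (hw y)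
          (Or.inr (measure_ne_top _ _))
      have h2 : Tendsto (fun N : ℕ => occupation κ x₀ N {x} + (N : ℝ≥0∞)⁻¹) U (𝓝 (w x + 0)) :=
        (hw x).add hinv
      rw [add_zero] at h2
      rw [hμs]
      refine le_trans (le_of_eq ?_) (le_of_tendsto_of_tendsto' h1 h2 fun N =>
        sum_occupation_mul_le κ x₀ N s x)
      exact Finset.sum_congr rfl fun y _ => by rw [hμs, mul_comm]
    refine Measure.le_iff.2 fun s _ => ?_
    rw [← Measure.tsum_indicator_apply_singleton _ s MeasurableSet.of_discrete,
      ← Measure.tsum_indicator_apply_singleton μ s MeasurableSet.of_discrete]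
    refine ENNReal.tsum_le_tsum fun x => ?_
    by_cases hx : x ∈ s
    · simpa [hx] using hpt x
    · simp [hx]
  have heq : μ.bind κ = μ := Measure.eq_of_le_of_measure_univ_eq hle hbu
  -- Foster's bound on the occupation of F survives the limit because F is finite; this keeps μ from
  -- being zero.
  have hF : 1 ≤ b * ∑ x ∈ F, w x := by
    have h1 : Tendsto (fun N : ℕ => V x₀ / N + b * ∑ x ∈ F, occupation κ x₀ N {x}) U
        (𝓝 (0 + b * ∑ x ∈ F, w x)) := by
      refine Tendsto.add ?_ (ENNReal.Tendsto.const_mul (tendsto_finsetSum F fun x _ => hw x)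
        (Or.inr hb))
      have := ENNReal.Tendsto.const_mul (a := V x₀) hinv (Or.inr hV)
      simpa [div_eq_mul_inv] using this
    rw [zero_add] at h1
    refine ge_of_tendsto h1 ?_
    filter_upwards [hU (eventually_ne_atTop 0)] with N hN
    rw [← occupation_finset]
    exact one_le_occupation_of_drift κ x₀ hd N hN
  have hμ0 : μ Set.univ ≠ 0 := by
    intro h0
    rw [hμu, ENNReal.tsum_eq_zero] at h0
    simp [h0] at hF
  refine ⟨(μ Set.univ)⁻¹ • μ, ⟨?_⟩, ?_⟩
  · simp [ENNReal.inv_mul_cancel hμ0 (measure_ne_top _ _)]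
  · rw [Kernel.Invariant, Measure.bind_smul, heq]

end MarkovChains

namespace AdaptiveMaxWeight

variable {n Δ : ℕ}

/-! ### Projection onto the cone -/

theorem par_mem (x : EuclideanSpace ℝ (Fin n × Fin n)) : par x ∈ cone n :=
  (Classical.choose_spec (existsUnique_nearest x).exists).1

theorem norm_perp_le (x z : EuclideanSpace ℝ (Fin n × Fin n)) (hz : z ∈ cone n) :
    ‖perp x‖ ≤ ‖x - z‖ :=
  (Classical.choose_spec (existsUnique_nearest x).exists).2 z hz

theorem par_add_perp (x : EuclideanSpace ℝ (Fin n × Fin n)) : par x + perp x = x := by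
  simp [perp]

theorem smul_mem_cone {c : ℝ} (hc : 0 ≤ c) {x : EuclideanSpace ℝ (Fin n × Fin n)}
    (hx : x ∈ cone n) : c • x ∈ cone n := by
  obtain ⟨w, v, hw, hv, h⟩ := hx
  refine ⟨fun i => c * w i, fun j => c * v j, fun i => mul_nonneg hc (hw i),
    fun j => mul_nonneg hc (hv j), fun i j => ?_⟩
  simp [h, mul_add]

theorem inner_perp_sub_nonpos (x : EuclideanSpace ℝ (Fin n × Fin n))
    {z : EuclideanSpace ℝ (Fin n × Fin n)} (hz : z ∈ cone n) :
    inner ℝ (perp x) (z - par x) ≤ 0 := by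
  refine (norm_eq_iInf_iff_real_inner_le_zero (cone_convex n) (par_mem x)).1 ?_ z hz
  have : Nonempty (cone n) := ⟨⟨_, par_mem x⟩⟩
  refine le_antisymm (le_ciInf fun z => norm_perp_le x z z.2) ?_
  exact ciInf_le (f := fun z : cone n => ‖x - z‖)
    ⟨0, by rintro _ ⟨z, rfl⟩; exact norm_nonneg _⟩ ⟨_, par_mem x⟩

/-- The ray through `par x` lies in the cone, so the variational inequality may be tested at 0 and
at twice `par x`; the two tests give opposite signs. -/
theorem inner_perp_par (x : EuclideanSpace ℝ (Fin n × Fin n)) :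
    inner ℝ (perp x) (par x) = 0 := by
  have h0 := inner_perp_sub_nonpos x (smul_mem_cone le_rfl (par_mem x))
  have h2 := inner_perp_sub_nonpos x (smul_mem_cone zero_le_two (par_mem x))
  rw [inner_sub_right, inner_smul_right] at h0 h2
  linarith

theorem inner_perp_nonpos (x : EuclideanSpace ℝ (Fin n × Fin n))
    {z : EuclideanSpace ℝ (Fin n × Fin n)} (hz : z ∈ cone n) : inner ℝ (perp x) z ≤ 0 := by
  have h := inner_perp_sub_nonpos x hz
  rwa [inner_sub_right, inner_perp_par, sub_zero] at h

theorem inner_self_perp (x : EuclideanSpace ℝ (Fin n × Fin n)) :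
    inner ℝ x (perp x) = ‖perp x‖ ^ 2 := by
  nth_rewrite 1 [← par_add_perp x]
  rw [inner_add_left, real_inner_comm, inner_perp_par, zero_add,
    real_inner_self_eq_norm_sq]

theorem norm_perp_le_norm (x : EuclideanSpace ℝ (Fin n × Fin n)) : ‖perp x‖ ≤ ‖x‖ := by
  have h := norm_perp_le x _ (smul_mem_cone le_rfl (par_mem x))
  simpa using h

theorem norm_par_le_norm (x : EuclideanSpace ℝ (Fin n × Fin n)) : ‖par x‖ ≤ ‖x‖ := by
  have h : ‖x‖ ^ 2 = ‖par x‖ ^ 2 + ‖perp x‖ ^ 2 := by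
    conv_lhs => rw [← par_add_perp x]
    rw [norm_add_sq_real, real_inner_comm, inner_perp_par]
    ring
  exact abs_le_of_sq_le_sq' (by nlinarith [sq_nonneg ‖perp x‖]) (norm_nonneg _) |>.2

theorem norm_le_par_add_perp (x : EuclideanSpace ℝ (Fin n × Fin n)) :
    ‖x‖ ≤ ‖par x‖ + ‖perp x‖ := by
  conv_lhs => rw [← par_add_perp x]
  exact norm_add_le _ _

theorem par_nonneg (x : EuclideanSpace ℝ (Fin n × Fin n)) (p : Fin n × Fin n) : 0 ≤ par x p :=
  ((mem_cone_iff _).1 (par_mem x)).1 p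

theorem inner_eq_sum (x y : EuclideanSpace ℝ (Fin n × Fin n)) :
    inner ℝ x y = ∑ i, ∑ j, x (i, j) * y (i, j) := by
  rw [PiLp.inner_apply, Fintype.sum_prod_type]
  simp [mul_comm]

theorem norm_sq_eq_sum (x : EuclideanSpace ℝ (Fin n × Fin n)) :
    ‖x‖ ^ 2 = ∑ i, ∑ j, x (i, j) ^ 2 := by
  rw [← real_inner_self_eq_norm_sq, inner_eq_sum]
  simp [sq]

@[simp]
theorem vec_apply (A : Fin n → Fin n → ℝ) (i j : Fin n) : vec A (i, j) = A i j := rfl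

@[simp]
theorem State.qvec_apply (x : State n Δ) (i j : Fin n) : x.qvec (i, j) = x.q i j := rfl

theorem abs_apply_le_norm (x : EuclideanSpace ℝ (Fin n × Fin n)) (p : Fin n × Fin n) :
    |x p| ≤ ‖x‖ := by
  simpa using PiLp.norm_apply_le x p

theorem row_sum_perp_nonpos (x : EuclideanSpace ℝ (Fin n × Fin n)) (i : Fin n) :
    ∑ j, perp x (i, j) ≤ 0 := by
  have hz : vec (fun k _ => if k = i then (1 : ℝ) else 0) ∈ cone n :=
    ⟨fun k => if k = i then 1 else 0, 0, fun k => by positivity, fun _ => le_rfl,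
      fun k j => by simp⟩
  have h := inner_perp_nonpos x hz
  rw [inner_eq_sum, Finset.sum_comm] at h
  simpa using h

theorem col_sum_perp_nonpos (x : EuclideanSpace ℝ (Fin n × Fin n)) (j : Fin n) :
    ∑ i, perp x (i, j) ≤ 0 := by
  have hz : vec (fun _ k => if k = j then (1 : ℝ) else 0) ∈ cone n :=
    ⟨0, fun k => if k = j then 1 else 0, fun _ => le_rfl, fun k => by positivity,
      fun k j => by simp⟩
  have h := inner_perp_nonpos x hz
  rw [inner_eq_sum] at h
  simpa using h

/-- Against the cone, no schedule does better than a saturated rate matrix. -/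
theorem sum_mul_le_of_mem_cone {z : EuclideanSpace ℝ (Fin n × Fin n)} (hz : z ∈ cone n)
    {A B : Fin n → Fin n → ℝ} (hAr : ∀ i, ∑ j, A i j ≤ 1) (hAc : ∀ j, ∑ i, A i j ≤ 1)
    (hBr : ∀ i, ∑ j, B i j = 1) (hBc : ∀ j, ∑ i, B i j = 1) :
    ∑ i, ∑ j, z (i, j) * A i j ≤ ∑ i, ∑ j, z (i, j) * B i j := by
  obtain ⟨w, v, hw, hv, h⟩ := hz
  have expand : ∀ A : Fin n → Fin n → ℝ, ∑ i, ∑ j, z (i, j) * A i j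
      = ∑ i, w i * ∑ j, A i j + ∑ j, v j * ∑ i, A i j := by
    intro A
    simp only [h, add_mul, Finset.sum_add_distrib, Finset.mul_sum]
    congr 1
    exact Finset.sum_comm
  rw [expand, expand]
  refine add_le_add (Finset.sum_le_sum fun i _ => ?_) (Finset.sum_le_sum fun j _ => ?_)
  · exact mul_le_mul_of_nonneg_left ((hAr i).trans (hBr i).ge) (hw i)
  · exact mul_le_mul_of_nonneg_left ((hAc j).trans (hBc j).ge) (hv j)

/-! ### Schedules of maximum weight -/

theorem Schedule.le_one (s : Schedule n) (i j : Fin n) : s.1 i j ≤ 1 :=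
  (Finset.single_le_sum (f := fun j => s.1 i j) (fun _ _ => Nat.zero_le _)
    (Finset.mem_univ j)).trans (s.2.2 i)

theorem Schedule.row_sum_le (s : Schedule n) (i : Fin n) : ∑ j, (s.1 i j : ℝ) ≤ 1 := by
  exact_mod_cast s.2.2 i

theorem Schedule.col_sum_le (s : Schedule n) (j : Fin n) : ∑ i, (s.1 i j : ℝ) ≤ 1 := by
  exact_mod_cast s.2.1 j

theorem weight_cast (q : Fin n → Fin n → ℕ) (s : Schedule n) :
    (weight q s : ℝ) = ∑ i, ∑ j, (q i j : ℝ) * s.1 i j := by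
  simp [weight]

theorem weight_le_sum (q : Fin n → Fin n → ℕ) (s : Schedule n) :
    weight q s ≤ ∑ i, ∑ j, q i j := by
  refine Finset.sum_le_sum fun i _ => Finset.sum_le_sum fun j _ => ?_
  exact mul_le_of_le_one_right (Nat.zero_le _) (s.le_one i j)

/-- The schedule that connects each input to its image under a permutation. -/
def permSchedule (σ : Equiv.Perm (Fin n)) : Schedule n :=
  ⟨fun i j => if σ i = j then 1 else 0, fun j => by
    simp only [← Equiv.eq_symm_apply]; simp, fun i => by simp⟩

/-- A matrix with row and column sums at most one is dominated by one with all these sums equal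
to one. -/
theorem exists_sum_eq_one_ge {A : Fin n → Fin n → ℝ}
    (hr : ∀ i, ∑ j, A i j ≤ 1) (hc : ∀ j, ∑ i, A i j ≤ 1) :
    ∃ B : Fin n → Fin n → ℝ, (∀ i j, A i j ≤ B i j) ∧ (∀ i, ∑ j, B i j = 1) ∧
      ∀ j, ∑ i, B i j = 1 := by
  set α : Fin n → ℝ := fun i => 1 - ∑ j, A i j with hα
  set β : Fin n → ℝ := fun j => 1 - ∑ i, A i j with hβ
  have hα0 : ∀ i, 0 ≤ α i := fun i => sub_nonneg.2 (hr i)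
  have hβ0 : ∀ j, 0 ≤ β j := fun j => sub_nonneg.2 (hc j)
  have hT : ∑ i, α i = ∑ j, β j := by
    simp only [hα, hβ, Finset.sum_sub_distrib]
    rw [Finset.sum_comm]
  rcases eq_or_ne (∑ i, α i) 0 with hz | hnz
  · refine ⟨A, fun _ _ => le_rfl, fun i => ?_, fun j => ?_⟩
    · have := (Finset.sum_eq_zero_iff_of_nonneg fun i _ => hα0 i).1 hz i (Finset.mem_univ i)
      simp only [hα] at this
      linarith
    · have := (Finset.sum_eq_zero_iff_of_nonneg fun j _ => hβ0 j).1 (hT ▸ hz) j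
        (Finset.mem_univ j)
      simp only [hβ] at this
      linarith
  -- The row defects α and column defects β have the same total, so a rank-one matrix fills both at
  -- once.
  · refine ⟨fun i j => A i j + α i * β j / ∑ i, α i, fun i j => ?_, fun i => ?_, fun j => ?_⟩
    · have := Finset.sum_nonneg fun i (_ : i ∈ Finset.univ) => hα0 i
      have := hα0 i
      have := hβ0 j
      have : 0 ≤ α i * β j / ∑ i, α i := by positivity
      linarith
    · rw [Finset.sum_add_distrib, ← Finset.sum_div, ← Finset.mul_sum, ← hT,
        mul_div_assoc, div_self hnz]
      simp [hα]
    · rw [Finset.sum_add_distrib, ← Finset.sum_div, ← Finset.sum_mul, mul_comm,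
        mul_div_assoc, div_self hnz]
      simp [hβ]

/-- The MaxWeight schedule beats every doubly substochastic matrix. -/
theorem Switch.sum_mul_le_weight_maxSched (S : Switch n Δ) (x : State n Δ)
    {A : Fin n → Fin n → ℝ} (h0 : ∀ i j, 0 ≤ A i j)
    (hr : ∀ i, ∑ j, A i j ≤ 1) (hc : ∀ j, ∑ i, A i j ≤ 1) :
    ∑ i, ∑ j, (x.q i j : ℝ) * A i j ≤ weight x.q (S.maxSched x) := by
  obtain ⟨B, hAB, hBr, hBc⟩ := exists_sum_eq_one_ge hr hc
  have hB : (Matrix.of B) ∈ doublyStochastic ℝ (Fin n) :=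
    mem_doublyStochastic_iff_sum.2 ⟨fun i j => (h0 i j).trans (hAB i j), hBr, hBc⟩
  obtain ⟨w, hw0, hw1, hwB⟩ := exists_eq_sum_perm_of_mem_doublyStochastic hB
  have hBe : ∀ i j, B i j = ∑ σ, w σ * ((permSchedule σ).1 i j : ℝ) := by
    intro i j
    have h := congrFun (congrFun hwB i) j
    rw [Matrix.sum_apply] at h
    rw [show B i j = Matrix.of B i j from rfl, ← h]
    refine Finset.sum_congr rfl fun σ _ => ?_
    simp [permSchedule, Equiv.Perm.permMatrix, PEquiv.toMatrix_apply, Equiv.toPEquiv_apply, eq_comm]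
  calc ∑ i, ∑ j, (x.q i j : ℝ) * A i j ≤ ∑ i, ∑ j, (x.q i j : ℝ) * B i j := by
        gcongr; exact hAB _ _
    _ = ∑ σ, w σ * (weight x.q (permSchedule σ) : ℝ) := by
        simp only [hBe, weight_cast, Finset.mul_sum]
        rw [Finset.sum_congr rfl fun i _ => Finset.sum_comm, Finset.sum_comm]
        refine Finset.sum_congr rfl fun σ _ => ?_
        refine Finset.sum_congr rfl fun i _ => Finset.sum_congr rfl fun j _ => ?_
        ring
    _ ≤ ∑ σ, w σ * (weight x.q (S.maxSched x) : ℝ) := by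
        refine Finset.sum_le_sum fun σ _ => mul_le_mul_of_nonneg_left ?_ (hw0 σ)
        exact_mod_cast S.maxSched_max x (permSchedule σ)
    _ = _ := by rw [← Finset.sum_mul, hw1, one_mul]

theorem IsSaturated.le {ν : Fin n → Fin n → ℝ} {m : ℝ} (h : IsSaturated ν m) (i j : Fin n) :
    m ≤ ν i j :=
  h.isLeast.2 ⟨(i, j), rfl⟩

/-- The maximum weight exceeds the weight of a saturated rate matrix by a multiple of the
distance to the cone. -/
theorem Switch.inner_add_le_weight_maxSched (S : Switch n Δ) (x : State n Δ)
    {ν : Fin n → Fin n → ℝ} {m : ℝ} (hm : 0 < m) (h : IsSaturated ν m) :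
    inner ℝ x.qvec (vec ν) + m * ‖perp x.qvec‖ ≤ weight x.q (S.maxSched x) := by
  -- The largest step along q_⊥ that surely keeps ν + t q_⊥ entrywise nonnegative. If q_⊥ = 0,
  -- division by zero gives t = 0, which is what is wanted.
  set t : ℝ := m / ‖perp x.qvec‖ with ht
  have ht0 : 0 ≤ t := div_nonneg hm.le (norm_nonneg _)
  have hle : t * ‖perp x.qvec‖ ≤ m := by
    rw [ht]
    rcases eq_or_ne ‖perp x.qvec‖ 0 with h0 | h0
    · rw [h0]; simpa using hm.le
    · rw [div_mul_cancel₀ _ h0]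
  have key := S.sum_mul_le_weight_maxSched x (A := fun i j => ν i j + t * perp x.qvec (i, j))
    (fun i j => ?_) (fun i => ?_) (fun j => ?_)
  · refine le_trans (le_of_eq ?_) key
    have h1 : m * ‖perp x.qvec‖ = t * inner ℝ x.qvec (perp x.qvec) := by
      rw [inner_self_perp, ht]
      rcases eq_or_ne ‖perp x.qvec‖ 0 with h0 | h0
      · rw [h0]; simp
      · field_simp
    rw [h1, inner_eq_sum, inner_eq_sum, Finset.mul_sum, ← Finset.sum_add_distrib]
    refine Finset.sum_congr rfl fun i _ => ?_
    rw [Finset.mul_sum, ← Finset.sum_add_distrib]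
    refine Finset.sum_congr rfl fun j _ => ?_
    simp only [State.qvec_apply, vec_apply]
    ring
  · have h1 := neg_le_of_abs_le (abs_apply_le_norm (perp x.qvec) (i, j))
    have h2 := h.le i j
    nlinarith
  · rw [Finset.sum_add_distrib, h.row_sum, ← Finset.mul_sum]
    nlinarith [row_sum_perp_nonpos x.qvec i]
  · rw [Finset.sum_add_distrib, h.col_sum, ← Finset.mul_sum]
    nlinarith [col_sum_perp_nonpos x.qvec j]

/-! ### The weight lost to reconfiguration and hysteresis -/

/-- The maximum weight of a schedule. -/
def Switch.maxWeight (S : Switch n Δ) (x : State n Δ) : ℕ :=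
  weight x.q (S.maxSched x)

/-- The difference between the maximum weight and the weight that is actually served. -/
def Switch.lostWeight (S : Switch n Δ) (x : State n Δ) : ℝ :=
  S.maxWeight x - if (x.r : ℕ) = 0 then (weight x.q x.s : ℝ) else 0

theorem weight_le_maxWeight (S : Switch n Δ) (x : State n Δ) (s : Schedule n) :
    weight x.q s ≤ S.maxWeight x :=
  S.maxSched_max x s

theorem weight_le_add {q q' : Fin n → Fin n → ℕ} {B : ℕ} (h : ∀ i j, q' i j ≤ q i j + B)
    (s : Schedule n) : weight q' s ≤ weight q s + n * n * B := by
  have h1 : ∀ i j, q' i j * s.1 i j ≤ q i j * s.1 i j + B := by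
    intro i j
    have h2 := h i j
    have h3 := s.le_one i j
    nlinarith
  calc weight q' s ≤ ∑ i, ∑ j, (q i j * s.1 i j + B) :=
        Finset.sum_le_sum fun i _ => Finset.sum_le_sum fun j _ => h1 i j
    _ = _ := by simp [weight, Finset.sum_add_distrib, mul_assoc]

theorem Switch.step_q_le (S : Switch n Δ) (g : ℝ → ℝ) (x : State n Δ) (a : Fin n → Fin n → ℕ)
    (i j : Fin n) : (S.step g x a).q i j ≤ x.q i j + a i j :=
  Nat.sub_le _ _

theorem Switch.le_step_q (S : Switch n Δ) (g : ℝ → ℝ) (x : State n Δ) (a : Fin n → Fin n → ℕ)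
    (i j : Fin n) : x.q i j ≤ (S.step g x a).q i j + 1 := by
  have h := x.s.le_one i j
  simp only [Switch.step]
  split_ifs <;> omega

section Step

variable (S : Switch n Δ) (g : ℝ → ℝ) (x : State n Δ) {a : Fin n → Fin n → ℕ} {amax : ℕ}

theorem Switch.weight_step_le (ha : ∀ i j, a i j ≤ amax) (s : Schedule n) :
    weight (S.step g x a).q s ≤ weight x.q s + n * n * (amax + 1) :=
  weight_le_add (fun i j => (S.step_q_le g x a i j).trans (by have := ha i j; omega)) s

theorem Switch.weight_le_step (a : Fin n → Fin n → ℕ) (amax : ℕ) (s : Schedule n) :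
    weight x.q s ≤ weight (S.step g x a).q s + n * n * (amax + 1) :=
  weight_le_add (fun i j => (S.le_step_q g x a i j).trans (by omega)) s

theorem Switch.maxWeight_step_le (ha : ∀ i j, a i j ≤ amax) :
    S.maxWeight (S.step g x a) ≤ S.maxWeight x + n * n * (amax + 1) :=
  (S.weight_step_le g x ha _).trans (Nat.add_le_add_right (weight_le_maxWeight S x _) _)

theorem Switch.step_s_of_reconfigures (a : Fin n → Fin n → ℕ) (h : S.Reconfigures g x) :
    (S.step g x a).s = S.maxSched x := by
  simp [Switch.step, h]

theorem Switch.step_s_of_not_reconfigures (a : Fin n → Fin n → ℕ) (h : ¬ S.Reconfigures g x) :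
    (S.step g x a).s = x.s := by
  simp [Switch.step, h]

theorem Switch.step_r_of_reconfigures (a : Fin n → Fin n → ℕ) (h : S.Reconfigures g x) :
    ((S.step g x a).r : ℕ) = Δ := by
  simp [Switch.step, h]

theorem Switch.step_r_of_not_reconfigures (a : Fin n → Fin n → ℕ) (h : ¬ S.Reconfigures g x) :
    ((S.step g x a).r : ℕ) = x.r - 1 := by
  simp [Switch.step, h]

end Step

/-- Sublinearity gives the slope δ beyond some point y₁; before it, monotonicity bounds g by g(y₁).
-/
theorem IsHysteresis.exists_le_mul_add {g : ℝ → ℝ} (hg : IsHysteresis g) {δ : ℝ} (hδ : 0 < δ) :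
    ∃ G : ℝ, 0 ≤ G ∧ ∀ y, 0 ≤ y → g y ≤ δ * y + G := by
  obtain ⟨y₀, hy₀⟩ := eventually_atTop.1 (hg.sublinear.eventually (gt_mem_nhds hδ))
  set y₁ := max y₀ 1
  have hy₁ : 0 < y₁ := lt_of_lt_of_le one_pos (le_max_right _ _)
  refine ⟨g y₁, hg.nonneg _ hy₁.le, fun y hy => ?_⟩
  rcases le_total y y₁ with h | h
  · have := hg.mono hy hy₁.le h
    have := mul_nonneg hδ.le hy
    linarith
  · have h1 := hy₀ y ((le_max_left _ _).trans h)
    rw [div_lt_iff₀ (hy₁.trans_le h)] at h1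
    have := hg.nonneg _ hy₁.le
    linarith

open Classical in
/-- Remaining reconfiguration time weighted by the maximum weight: it pays for the service that is
lost during reconfigurations, and is itself charged when a reconfiguration begins. -/
theorem Switch.remaining_time_drift (S : Switch n Δ) (g : ℝ → ℝ) (x : State n Δ)
    {a : Fin n → Fin n → ℕ} {amax : ℕ} (ha : ∀ i j, a i j ≤ amax) :
    (S.maxWeight (S.step g x a) : ℝ) * ((S.step g x a).r : ℕ)
      + (if (x.r : ℕ) = 0 then 0 else (S.maxWeight x : ℝ))
    ≤ S.maxWeight x * (x.r : ℕ)
      + (Δ + 1) * (if S.Reconfigures g x then (S.maxWeight x : ℝ) else 0)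
      + (n * n * (amax + 1) : ℕ) * Δ := by
  have h1 : (S.maxWeight (S.step g x a) : ℝ) ≤ S.maxWeight x + (n * n * (amax + 1) : ℕ) := by
    exact_mod_cast S.maxWeight_step_le g x ha
  set C : ℝ := ((n * n * (amax + 1) : ℕ) : ℝ)
  have hC : 0 ≤ C := Nat.cast_nonneg _
  have hw : (0 : ℝ) ≤ S.maxWeight x := Nat.cast_nonneg _
  have hr : ((x.r : ℕ) : ℝ) ≤ Δ := by exact_mod_cast Nat.lt_succ_iff.1 x.r.isLt
  have hΔ : (0 : ℝ) ≤ Δ := Nat.cast_nonneg _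
  have hr0 : (0 : ℝ) ≤ (x.r : ℕ) := Nat.cast_nonneg _
  by_cases h : S.Reconfigures g x
  · rw [S.step_r_of_reconfigures g x a h, if_pos h]
    have h2 : (if (x.r : ℕ) = 0 then 0 else (S.maxWeight x : ℝ)) ≤ S.maxWeight x := by
      split_ifs <;> simp
    nlinarith [mul_nonneg hw hr0]
  · rw [S.step_r_of_not_reconfigures g x a h, if_neg h]
    by_cases h0 : (x.r : ℕ) = 0
    · simp only [h0, if_true]
      simp only [zero_tsub, Nat.cast_zero, mul_zero, add_zero, zero_add]
      positivity
    · rw [if_neg h0, Nat.cast_sub (Nat.one_le_iff_ne_zero.2 h0)]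
      have h3 : (1 : ℝ) ≤ (x.r : ℕ) := by exact_mod_cast Nat.one_le_iff_ne_zero.2 h0
      push_cast
      nlinarith [mul_nonneg hC hr0, mul_le_mul_of_nonneg_left hr hC]

open Classical in
/-- The weight gap, truncated at a level `K` below the threshold and weighted by the maximum
weight: it increases slowly and drops at every reconfiguration. -/
theorem Switch.truncated_gap_drift (S : Switch n Δ) {g : ℝ → ℝ} (x : State n Δ)
    {a : Fin n → Fin n → ℕ} {amax : ℕ} (ha : ∀ i j, a i j ≤ amax) {K w₀ : ℝ} (hK : 1 ≤ K)
    (hw₀ : 0 ≤ w₀) (hgK : ∀ y, w₀ ≤ y → K ≤ g y) :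
    (S.maxWeight (S.step g x a) : ℝ) * min ((S.maxWeight (S.step g x a) : ℝ)
        - weight (S.step g x a).q (S.step g x a).s) K
      + K * (if S.Reconfigures g x then (S.maxWeight x : ℝ) else 0)
    ≤ S.maxWeight x * min ((S.maxWeight x : ℝ) - weight x.q x.s) K
      + 2 * (n * n * (amax + 1) : ℕ) * S.maxWeight x
      + K * (2 * w₀ + (n * n * (amax + 1) : ℕ) + 2 * (n * n * (amax + 1) : ℕ) ^ 2) := by
  have h1 : (S.maxWeight (S.step g x a) : ℝ) ≤ S.maxWeight x + (n * n * (amax + 1) : ℕ) := by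
    exact_mod_cast S.maxWeight_step_le g x ha
  have h2 : ∀ s, (weight x.q s : ℝ) ≤ weight (S.step g x a).q s + (n * n * (amax + 1) : ℕ) := by
    intro s; exact_mod_cast S.weight_le_step g x a amax s
  have hD' : (0 : ℝ) ≤ (S.maxWeight (S.step g x a) : ℝ)
      - weight (S.step g x a).q (S.step g x a).s := by
    rw [sub_nonneg]; exact_mod_cast weight_le_maxWeight S _ _
  have hD : (0 : ℝ) ≤ (S.maxWeight x : ℝ) - weight x.q x.s := by
    rw [sub_nonneg]; exact_mod_cast weight_le_maxWeight S _ _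
  have hw : (0 : ℝ) ≤ S.maxWeight x := Nat.cast_nonneg _
  have hw' : (0 : ℝ) ≤ S.maxWeight (S.step g x a) := Nat.cast_nonneg _
  have hC : (0 : ℝ) ≤ (n * n * (amax + 1) : ℕ) := Nat.cast_nonneg _
  have hK0 : 0 ≤ K := by linarith
  by_cases h : S.Reconfigures g x
  · have hs := S.step_s_of_reconfigures g x a h
    have h3 := h2 (S.maxSched x)
    change (S.maxWeight x : ℝ) ≤ _ at h3
    rw [hs] at hD' ⊢
    rw [if_pos h]
    have h4 : (S.maxWeight x : ℝ) - weight x.q x.s > g (S.maxWeight x) := h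
    generalize ((n * n * (amax + 1) : ℕ) : ℝ) = C at *
    generalize (S.maxWeight x : ℝ) = w at *
    generalize (S.maxWeight (S.step g x a) : ℝ) = w' at *
    set D' := w' - (weight (S.step g x a).q (S.maxSched x) : ℝ)
    have hD'le : D' ≤ 2 * C := by simp only [D']; linarith
    have hm0 : 0 ≤ min D' K := le_min hD' hK0
    -- For w ≥ w₀ the old gap exceeds g(w) ≥ K, so its truncation is exactly K, while the new gap is
    -- at most 2C because the old maximizer is now in force. For w < w₀ everything is bounded and
    -- goes into the constant.
    rcases le_or_gt w₀ w with hw0 | hw0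
    · rw [min_eq_right (a := w - _) ((hgK _ hw0).trans h4.le)]
      have h5 : min D' K ≤ 2 * C := (min_le_left _ _).trans hD'le
      have h6 : w' * min D' K ≤ (w + C) * (2 * C) := mul_le_mul h1 h5 hm0 (by linarith)
      nlinarith [mul_nonneg hK0 hw₀, mul_nonneg hK0 hC,
        mul_nonneg (sub_nonneg.2 hK) (sq_nonneg C)]
    · have h6 : w' * min D' K ≤ (w₀ + C) * K :=
        mul_le_mul (by linarith) (min_le_right _ _) hm0 (by linarith)
      have h7 : 0 ≤ w * min (w - (weight x.q x.s : ℝ)) K := mul_nonneg hw (le_min hD hK0)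
      nlinarith [mul_nonneg hK0 (sq_nonneg C), mul_nonneg hC hw,
        mul_le_mul_of_nonneg_left hw0.le hK0]
  · have hs := S.step_s_of_not_reconfigures g x a h
    have h3 := h2 x.s
    rw [hs] at hD' ⊢
    rw [if_neg h]
    generalize ((n * n * (amax + 1) : ℕ) : ℝ) = C at *
    generalize (S.maxWeight x : ℝ) = w at *
    generalize (S.maxWeight (S.step g x a) : ℝ) = w' at *
    set D' := w' - (weight (S.step g x a).q x.s : ℝ)
    set D := w - (weight x.q x.s : ℝ)
    have hD'le : D' ≤ D + 2 * C := by simp only [D', D]; linarith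
    have hm0 : 0 ≤ min D' K := le_min hD' hK0
    have h5 : min D' K ≤ min D K + 2 * C := by
      rw [min_add]
      exact min_le_min hD'le (by linarith)
    have h6 : w' * min D' K ≤ (w + C) * min D' K := mul_le_mul_of_nonneg_right h1 hm0
    have h7 := mul_le_mul_of_nonneg_left h5 hw
    have h8 := mul_le_mul_of_nonneg_left (min_le_right D' K) hC
    nlinarith [mul_nonneg hK0 (sq_nonneg C), mul_nonneg hK0 hw₀]

-- When the switch is serving and no reconfiguration is triggered, the failed test says that the gap
-- is at most g(W*). Otherwise an indicator term supplies all of W*.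
open Classical in
theorem Switch.lostWeight_le (S : Switch n Δ) {g : ℝ → ℝ} (hg : IsHysteresis g)
    (x : State n Δ) :
    S.lostWeight x ≤ g (S.maxWeight x) + (if (x.r : ℕ) = 0 then 0 else (S.maxWeight x : ℝ))
      + (if S.Reconfigures g x then (S.maxWeight x : ℝ) else 0) := by
  have h0 := hg.nonneg (S.maxWeight x) (Nat.cast_nonneg _)
  have hw : (0 : ℝ) ≤ S.maxWeight x := Nat.cast_nonneg _
  have hW : (0 : ℝ) ≤ weight x.q x.s := Nat.cast_nonneg _
  unfold Switch.lostWeight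
  by_cases hr : (x.r : ℕ) = 0
  · rw [if_pos hr, if_pos hr]
    by_cases h : S.Reconfigures g x
    · rw [if_pos h]; linarith
    · rw [if_neg h]
      have h1 : ¬ ((S.maxWeight x : ℝ) - weight x.q x.s > g (S.maxWeight x)) := h
      linarith
  · rw [if_neg hr, if_neg hr]
    have : 0 ≤ (if S.Reconfigures g x then (S.maxWeight x : ℝ) else 0) := by positivity
    linarith

/-- There is a potential that pays for the lost weight, up to a small multiple of the maximum
weight and a constant that is the same for all switches. -/
theorem exists_compensator {g : ℝ → ℝ} (hg : IsHysteresis g) (n Δ amax : ℕ) {η : ℝ}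
    (hη : 0 < η) :
    ∃ c : ℝ, 0 ≤ c ∧ ∀ S : Switch n Δ, ∃ Ψ : State n Δ → ℝ, (∀ x, 0 ≤ Ψ x) ∧
      ∀ x a, (∀ i j, a i j ≤ amax) →
        Ψ (S.step g x a) + 2 * S.lostWeight x ≤ Ψ x + η * S.maxWeight x + c := by
  classical
  obtain ⟨G, hG0, hG⟩ := hg.exists_le_mul_add (δ := η / 4) (by positivity)
  set C : ℝ := ((n * n * (amax + 1) : ℕ) : ℝ) with hCdef
  have hC : 0 ≤ C := Nat.cast_nonneg _
  -- Twice the lost weight contains twice the reconfiguration indicator directly, and 2(Δ + 1) times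
  -- it through the remaining-time potential.
  set A : ℝ := 2 * (Δ + 2) with hA
  have hA0 : 0 ≤ A := by positivity
  -- Chosen so that the growth 2AC/K of the scaled truncated gap uses half of η; the other half pays
  -- for 2g with slope η/4.
  set K : ℝ := max 1 (4 * A * C / η)
  have hK : 1 ≤ K := le_max_left _ _
  have hKpos : 0 < K := by linarith
  have hAK : 2 * A * C / K ≤ η / 2 := by
    rw [div_le_iff₀ hKpos]
    have : 4 * A * C / η ≤ K := le_max_right _ _
    rw [div_le_iff₀ hη] at this
    linarith
  obtain ⟨w₁, hw₁⟩ := eventually_atTop.1 (hg.unbounded.eventually_ge_atTop K)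
  set w₀ := max w₁ 0
  have hw₀ : 0 ≤ w₀ := le_max_right _ _
  have hgK : ∀ y, w₀ ≤ y → K ≤ g y := fun y hy => hw₁ y ((le_max_left _ _).trans hy)
  refine ⟨2 * G + 2 * C * Δ + A * (2 * w₀ + C + 2 * C ^ 2), by positivity, fun S =>
    ⟨fun x => 2 * (S.maxWeight x * (x.r : ℕ))
      + A / K * (S.maxWeight x * min ((S.maxWeight x : ℝ) - weight x.q x.s) K),
      fun x => ?_, fun x a ha => ?_⟩⟩
  · have h1 : 0 ≤ min ((S.maxWeight x : ℝ) - weight x.q x.s) K := by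
      refine le_min ?_ hKpos.le
      rw [sub_nonneg]; exact_mod_cast weight_le_maxWeight S _ _
    positivity
  · have h1 := S.remaining_time_drift g x ha
    have h2 := mul_le_mul_of_nonneg_left (S.truncated_gap_drift x ha hK hw₀ hgK)
      (div_nonneg hA0 hKpos.le)
    have h3 := S.lostWeight_le hg x
    have hw : (0 : ℝ) ≤ S.maxWeight x := Nat.cast_nonneg _
    have h4 := hG _ hw
    have h5 := mul_le_mul_of_nonneg_right hAK hw
    simp only [← hCdef] at h1 h2
    have e1 : ∀ y, A / K * (K * y) = A * y := fun y => by field_simp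
    rw [mul_add, mul_add, mul_add, e1, e1] at h2
    have e2 : A / K * (2 * C * (S.maxWeight x : ℝ)) = 2 * A * C / K * S.maxWeight x := by ring
    rw [e2] at h2
    rw [hA] at *
    linarith

/-! ### The state space and the transition kernel -/

instance State.discreteMeasurableSpace : DiscreteMeasurableSpace (State n Δ) :=
  ⟨fun _ => trivial⟩

instance Schedule.finite : Finite (Schedule n) := by
  have h : Function.Injective (fun (s : Schedule n) (i j : Fin n) =>
      (⟨s.1 i j, Nat.lt_succ_iff.2 (s.le_one i j)⟩ : Fin 2)) := by
    intro s t hst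
    refine Subtype.ext (funext fun i => funext fun j => ?_)
    exact congrArg Fin.val (congrFun (congrFun hst i) j)
  exact Finite.of_injective _ h

theorem State.injective_toProd : Function.Injective
    (fun x : State n Δ => ((x.q, x.s, x.r) : (Fin n → Fin n → ℕ) × Schedule n × Fin (Δ + 1))) := by
  rintro ⟨q, s, r⟩ ⟨q', s', r'⟩ h
  simp only [Prod.mk.injEq] at h
  obtain ⟨rfl, rfl, rfl⟩ := h
  rfl

instance State.countable : Countable (State n Δ) := State.injective_toProd.countable

/-- The total queue length. -/
def State.total (x : State n Δ) : ℝ := ∑ i, ∑ j, (x.q i j : ℝ)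

theorem State.le_total (x : State n Δ) (i j : Fin n) : (x.q i j : ℝ) ≤ x.total :=
  (Finset.single_le_sum (f := fun j => (x.q i j : ℝ)) (fun _ _ => Nat.cast_nonneg _)
    (Finset.mem_univ j)).trans
  (Finset.single_le_sum (f := fun i => ∑ j, (x.q i j : ℝ))
    (fun _ _ => Finset.sum_nonneg fun _ _ => Nat.cast_nonneg _) (Finset.mem_univ i))

theorem State.total_nonneg (x : State n Δ) : 0 ≤ x.total :=
  Finset.sum_nonneg fun _ _ => Finset.sum_nonneg fun _ _ => Nat.cast_nonneg _

theorem State.finite_total_le (R : ℝ) : {x : State n Δ | x.total ≤ R}.Finite := by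
  have h := Set.finite_Iic (fun _ _ => ⌊R⌋₊ : Fin n → Fin n → ℕ)
  refine ((h.prod (Set.finite_univ (α := Schedule n × Fin (Δ + 1)))).preimage
    State.injective_toProd.injOn).subset fun x hx => ?_
  refine ⟨fun i j => ?_, trivial⟩
  exact Nat.le_floor ((x.le_total i j).trans hx)

theorem Switch.maxWeight_le_total (S : Switch n Δ) (x : State n Δ) :
    (S.maxWeight x : ℝ) ≤ x.total := by
  have := weight_le_sum x.q (S.maxSched x)
  unfold State.total Switch.maxWeight
  exact_mod_cast this

theorem State.norm_qvec_le_total (x : State n Δ) : ‖x.qvec‖ ≤ x.total := by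
  refine abs_le_of_sq_le_sq' ?_ x.total_nonneg |>.2
  rw [norm_sq_eq_sum]
  calc ∑ i, ∑ j, x.qvec (i, j) ^ 2 ≤ ∑ i, ∑ j, (x.q i j : ℝ) * x.total := by
        gcongr with i _ j _
        rw [State.qvec_apply, sq]
        exact mul_le_mul_of_nonneg_left (x.le_total i j) (Nat.cast_nonneg _)
    _ = x.total ^ 2 := by simp only [← Finset.sum_mul]; rw [sq]; rfl

theorem State.total_le_norm_qvec (x : State n Δ) : x.total ≤ n ^ 2 * ‖x.qvec‖ := by
  calc x.total ≤ ∑ _i : Fin n, ∑ _j : Fin n, ‖x.qvec‖ := by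
        unfold State.total
        gcongr with i _ j _
        exact (le_abs_self _).trans (abs_apply_le_norm x.qvec (i, j))
    _ = _ := by simp; ring

instance Switch.isProbabilityMeasure_arrivalLaw (S : Switch n Δ) :
    IsProbabilityMeasure S.arrivalLaw := by
  unfold Switch.arrivalLaw; infer_instance

instance Switch.isMarkovKernel_transition (S : Switch n Δ) (g : ℝ → ℝ) :
    IsMarkovKernel (S.transition g) :=
  ⟨fun _ => Measure.isProbabilityMeasure_map Measurable.of_discrete.aemeasurable⟩

theorem Switch.measurePreserving_arrival (S : Switch n Δ) (i j : Fin n) :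
    MeasurePreserving (fun a : Fin n → Fin n → ℕ => a i j) S.arrivalLaw
      (S.arrival i j).toMeasure :=
  (measurePreserving_eval (fun j => (S.arrival i j).toMeasure) j).comp
    (measurePreserving_eval (fun i => Measure.pi fun j => (S.arrival i j).toMeasure) i)

/-! ### Expectations over one slot and stationary drift inequalities -/

section Expectation

variable {S : Switch n Δ} {g : ℝ → ℝ} {amax : ℕ} {σ ε : ℝ} {ν : Fin n → Fin n → ℝ}

theorem Switch.HasTraffic.ae_le (hS : S.HasTraffic amax σ ν ε) :
    ∀ᵐ a ∂S.arrivalLaw, ∀ i j, a i j ≤ amax := by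
  rw [ae_all_iff]; intro i
  rw [ae_all_iff]; intro j
  have h : ∀ᵐ k ∂(S.arrival i j).toMeasure, k ≤ amax := by
    rw [ae_iff, PMF.toMeasure_apply_eq_zero_iff _ MeasurableSet.of_discrete,
      Set.disjoint_left]
    exact fun k hk hk' => hk' (hS.bounded i j k hk)
  exact (S.measurePreserving_arrival i j).quasiMeasurePreserving.ae h

/-- Almost surely the arrival matrix takes finitely many values, so every function of it is
essentially bounded. -/
theorem Switch.HasTraffic.integrable (hS : S.HasTraffic amax σ ν ε)
    (F : (Fin n → Fin n → ℕ) → ℝ) : Integrable F S.arrivalLaw := by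
  have hfin : Set.Finite {a : Fin n → Fin n → ℕ | ∀ i j, a i j ≤ amax} := by
    refine (Set.finite_Iic (fun _ _ => amax : Fin n → Fin n → ℕ)).subset fun a ha => ?_
    exact fun i j => ha i j
  obtain ⟨B, hB⟩ := (hfin.image fun a => ‖F a‖).bddAbove
  refine Integrable.of_bound Measurable.of_discrete.aestronglyMeasurable B ?_
  filter_upwards [hS.ae_le] with a ha
  exact hB ⟨a, ha, rfl⟩

theorem Switch.HasTraffic.integral_affine (hS : S.HasTraffic amax σ ν ε) (k : ℝ)
    (c : Fin n → Fin n → ℝ) :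
    ∫ a, (k + ∑ i, ∑ j, c i j * (a i j : ℝ)) ∂S.arrivalLaw
      = k + ∑ i, ∑ j, c i j * ((1 - ε) * ν i j) := by
  rw [integral_add (hS.integrable _) (hS.integrable _), integral_const,
    integral_finsetSum _ fun _ _ => hS.integrable _]
  simp only [probReal_univ, one_smul]
  congr 1
  refine Finset.sum_congr rfl fun i _ => ?_
  rw [integral_finsetSum _ fun _ _ => hS.integrable _]
  refine Finset.sum_congr rfl fun j _ => ?_
  rw [integral_const_mul, ← hS.mean i j, ← (S.measurePreserving_arrival i j).map_eq,
    integral_map (S.measurePreserving_arrival i j).measurable.aemeasurable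
      Measurable.of_discrete.aestronglyMeasurable]

theorem Switch.HasTraffic.lintegral_transition (hS : S.HasTraffic amax σ ν ε)
    {V : State n Δ → ℝ} (hV : ∀ x, 0 ≤ V x) (x : State n Δ) :
    ∫⁻ y, ENNReal.ofReal (V y) ∂S.transition g x
      = ENNReal.ofReal (∫ a, V (S.step g x a) ∂S.arrivalLaw) := by
  rw [ofReal_integral_eq_lintegral_ofReal (hS.integrable _) (ae_of_all _ fun a => hV _)]
  exact lintegral_map Measurable.of_discrete Measurable.of_discrete

/-- Requiring a bound that is affine in the arrivals reduces a drift check to pointwise algebra: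
only the rates (1 - ε)ν enter the expectation. -/
theorem Switch.HasTraffic.drift_le (hS : S.HasTraffic amax σ ν ε) {V f h : State n Δ → ℝ}
    (hV : ∀ x, 0 ≤ V x) (hf : ∀ x, 0 ≤ f x) (hh : ∀ x, 0 ≤ h x)
    (hd : ∀ x, ∃ (k : ℝ) (c : Fin n → Fin n → ℝ),
      (∀ a : Fin n → Fin n → ℕ, (∀ i j, a i j ≤ amax) →
        V (S.step g x a) ≤ k + ∑ i, ∑ j, c i j * (a i j : ℝ)) ∧
      k + ∑ i, ∑ j, c i j * ((1 - ε) * ν i j) + f x ≤ V x + h x) (x : State n Δ) :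
    ∫⁻ y, ENNReal.ofReal (V y) ∂S.transition g x + ENNReal.ofReal (f x)
      ≤ ENNReal.ofReal (V x) + ENNReal.ofReal (h x) := by
  obtain ⟨k, c, h1, h2⟩ := hd x
  rw [hS.lintegral_transition hV, ← ENNReal.ofReal_add (integral_nonneg fun a => hV _) (hf x),
    ← ENNReal.ofReal_add (hV x) (hh x)]
  refine ENNReal.ofReal_le_ofReal (le_trans ?_ h2)
  gcongr
  rw [← hS.integral_affine]
  refine integral_mono_ae (hS.integrable _) (hS.integrable _) ?_
  filter_upwards [hS.ae_le] with a ha using h1 a ha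

theorem integral_le_of_lintegral_ofReal_le {α : Type*} [MeasurableSpace α]
    [DiscreteMeasurableSpace α] {π : Measure α} {f h : α → ℝ} (hf : ∀ x, 0 ≤ f x)
    (hh : ∀ x, 0 ≤ h x) (hi : Integrable h π)
    (hle : ∫⁻ x, ENNReal.ofReal (f x) ∂π ≤ ∫⁻ x, ENNReal.ofReal (h x) ∂π) :
    Integrable f π ∧ ∫ x, f x ∂π ≤ ∫ x, h x ∂π := by
  rw [← ofReal_integral_eq_lintegral_ofReal hi (ae_of_all _ hh)] at hle
  have hfi : Integrable f π := by
    refine ⟨Measurable.of_discrete.aestronglyMeasurable, ?_⟩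
    rw [hasFiniteIntegral_iff_ofReal (ae_of_all _ hf)]
    exact hle.trans_lt ENNReal.ofReal_lt_top
  rw [← ofReal_integral_eq_lintegral_ofReal hfi (ae_of_all _ hf)] at hle
  exact ⟨hfi, (ENNReal.ofReal_le_ofReal_iff (integral_nonneg hh)).1 hle⟩

/-- A drift condition bounds a stationary mean. -/
theorem Switch.HasTraffic.integral_le_of_drift (hS : S.HasTraffic amax σ ν ε)
    {π : Measure (State n Δ)} (hπ : S.IsSteadyState g π) {V f h : State n Δ → ℝ}
    (hV : ∀ x, 0 ≤ V x) (hf : ∀ x, 0 ≤ f x) (hh : ∀ x, 0 ≤ h x) (hi : Integrable h π)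
    (hd : ∀ x, ∃ (k : ℝ) (c : Fin n → Fin n → ℝ),
      (∀ a : Fin n → Fin n → ℕ, (∀ i j, a i j ≤ amax) →
        V (S.step g x a) ≤ k + ∑ i, ∑ j, c i j * (a i j : ℝ)) ∧
      k + ∑ i, ∑ j, c i j * ((1 - ε) * ν i j) + f x ≤ V x + h x) :
    Integrable f π ∧ ∫ x, f x ∂π ≤ ∫ x, h x ∂π := by
  have := hπ.isProbabilityMeasure
  exact integral_le_of_lintegral_ofReal_le hf hh hi
    (lintegral_le_of_drift hπ.invariant (V := fun x => ENNReal.ofReal (V x))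
      (fun x => ENNReal.ofReal_ne_top) (hS.drift_le hV hf hh hd))

/-- A reverse drift condition bounds a stationary mean. -/
theorem Switch.HasTraffic.integral_le_of_reverse_drift (hS : S.HasTraffic amax σ ν ε)
    {π : Measure (State n Δ)} (hπ : S.IsSteadyState g π) {V f h : State n Δ → ℝ}
    (hV : ∀ x, 0 ≤ V x) (hVi : Integrable V π) (hf : ∀ x, 0 ≤ f x) (hh : ∀ x, 0 ≤ h x)
    (hi : Integrable h π)
    (hd : ∀ x, ∃ (k : ℝ) (c : Fin n → Fin n → ℝ),
      (∀ a : Fin n → Fin n → ℕ, (∀ i j, a i j ≤ amax) →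
        k + ∑ i, ∑ j, c i j * (a i j : ℝ) ≤ V (S.step g x a)) ∧
      V x + f x ≤ k + ∑ i, ∑ j, c i j * ((1 - ε) * ν i j) + h x) :
    ∫ x, f x ∂π ≤ ∫ x, h x ∂π := by
  refine (integral_le_of_lintegral_ofReal_le hf hh hi
    (lintegral_le_of_reverse_drift hπ.invariant (V := fun x => ENNReal.ofReal (V x))
      ?_ fun x => ?_)).2
  · rw [← ofReal_integral_eq_lintegral_ofReal hVi (ae_of_all _ hV)]
    exact ENNReal.ofReal_ne_top
  · obtain ⟨k, c, h1, h2⟩ := hd x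
    rw [hS.lintegral_transition hV, ← ENNReal.ofReal_add (integral_nonneg fun a => hV _) (hh x),
      ← ENNReal.ofReal_add (hV x) (hf x)]
    refine ENNReal.ofReal_le_ofReal (h2.trans ?_)
    gcongr
    rw [← hS.integral_affine]
    refine integral_mono_ae (hS.integrable _) (hS.integrable _) ?_
    filter_upwards [hS.ae_le] with a ha using h1 a ha

end Expectation

/-! ### Quadratic drift -/

/-- The service that is offered in a state. -/
def State.service (x : State n Δ) (i j : Fin n) : ℕ := if (x.r : ℕ) = 0 then x.s.1 i j else 0

theorem State.service_le (x : State n Δ) (i j : Fin n) : x.service i j ≤ x.s.1 i j := by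
  unfold State.service; split_ifs <;> simp

theorem State.sum_mul_service (x : State n Δ) :
    ∑ i, ∑ j, (x.q i j : ℝ) * x.service i j
      = if (x.r : ℕ) = 0 then (weight x.q x.s : ℝ) else 0 := by
  unfold State.service
  split_ifs
  · rw [weight_cast]
  · simp

/-- Without truncation this expands the square with |a - s| ≤ amax + 1. Truncation occurs only for q
= a = 0 and s = 1; there p ≥ 0 gives the cross term 2p the right sign. -/
theorem sq_queue_sub_le {q a s amax : ℕ} {p : ℝ} (hp : 0 ≤ p) (hs : s ≤ 1) (ha : a ≤ amax) :
    (((q + a - s : ℕ) : ℝ) - p) ^ 2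
      ≤ (q - p) ^ 2 + 2 * (q - p) * ((a : ℝ) - s) + (amax + 1) ^ 2 := by
  have h1 : (a : ℝ) ≤ amax := by exact_mod_cast ha
  have h2 : (s : ℝ) ≤ 1 := by exact_mod_cast hs
  have h3 : (0 : ℝ) ≤ a := Nat.cast_nonneg _
  have h4 : (0 : ℝ) ≤ s := Nat.cast_nonneg _
  rcases le_or_gt s (q + a) with h | h
  · rw [Nat.cast_sub h]
    push_cast
    nlinarith
  · obtain rfl : q = 0 := by omega
    obtain rfl : a = 0 := by omega
    obtain rfl : s = 1 := by omega
    simp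
    nlinarith

/-- The reference point p is free so that p = 0 serves for ‖q‖² and p = q_∥, frozen during the slot,
serves for ‖q_⊥‖². -/
theorem Switch.norm_sq_step_sub_le (S : Switch n Δ) (g : ℝ → ℝ) (x : State n Δ)
    {a : Fin n → Fin n → ℕ} {amax : ℕ} (ha : ∀ i j, a i j ≤ amax)
    {p : EuclideanSpace ℝ (Fin n × Fin n)} (hp : ∀ k, 0 ≤ p k) :
    ‖(S.step g x a).qvec - p‖ ^ 2 ≤ ‖x.qvec - p‖ ^ 2
      - 2 * ∑ i, ∑ j, (x.qvec - p) (i, j) * x.service i j + n ^ 2 * (amax + 1) ^ 2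
      + ∑ i, ∑ j, 2 * (x.qvec - p) (i, j) * (a i j : ℝ) := by
  have h1 : ∀ i j, ((S.step g x a).qvec - p) (i, j) ^ 2 ≤ (x.qvec - p) (i, j) ^ 2
      - 2 * ((x.qvec - p) (i, j) * x.service i j) + (amax + 1) ^ 2
      + 2 * (x.qvec - p) (i, j) * (a i j : ℝ) := by
    intro i j
    refine (sq_queue_sub_le (q := x.q i j) (hp (i, j))
      ((x.service_le i j).trans (x.s.le_one i j)) (ha i j)).trans (le_of_eq ?_)
    simp only [PiLp.sub_apply, State.qvec_apply]
    ring
  rw [norm_sq_eq_sum, norm_sq_eq_sum]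
  refine (Finset.sum_le_sum fun i _ => Finset.sum_le_sum fun j _ => h1 i j).trans (le_of_eq ?_)
  simp only [Finset.sum_add_distrib, Finset.sum_sub_distrib, ← Finset.mul_sum]
  simp
  ring

/-! ### Steady states, finite means and weak state space collapse -/

section Bounds

variable {S : Switch n Δ} {g : ℝ → ℝ} {amax : ℕ} {σ ε m : ℝ} {ν : Fin n → Fin n → ℝ}

theorem IsSaturated.nonneg (hν : IsSaturated ν m) (hm : 0 < m) (i j : Fin n) : 0 ≤ ν i j :=
  hm.le.trans (hν.le i j)

theorem IsSaturated.pos_dim (hν : IsSaturated ν m) : 0 < n := by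
  obtain ⟨⟨i, _⟩, _⟩ := hν.isLeast.1
  exact i.pos

theorem IsSaturated.le_norm (hν : IsSaturated ν m) : m ≤ ‖vec ν‖ := by
  obtain ⟨⟨i, j⟩, h⟩ := hν.isLeast.1
  have h1 := (le_abs_self _).trans (abs_apply_le_norm (vec ν) (i, j))
  rw [vec_apply] at h1
  exact h.symm.le.trans h1

theorem IsSaturated.lt_one (hν : IsSaturated ν m) (hm : 0 < m)
    (hε : ε ≤ m / (4 * ‖vec ν‖)) : ε < 1 := by
  have h1 := hν.le_norm
  refine hε.trans_lt ?_
  rw [div_lt_one (by linarith)]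
  linarith

theorem inner_qvec_eq (x : State n Δ) (ν : Fin n → Fin n → ℝ) :
    inner ℝ x.qvec (vec ν) = ∑ i, ∑ j, (x.q i j : ℝ) * ν i j := by
  rw [inner_eq_sum]; rfl

theorem IsSaturated.mul_total_le (hν : IsSaturated ν m) (x : State n Δ) :
    m * x.total ≤ inner ℝ x.qvec (vec ν) := by
  rw [inner_qvec_eq]
  unfold State.total
  simp only [Finset.mul_sum]
  refine Finset.sum_le_sum fun i _ => Finset.sum_le_sum fun j _ => ?_
  rw [mul_comm]
  exact mul_le_mul_of_nonneg_left (hν.le i j) (Nat.cast_nonneg _)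

/-- Drift of the squared norm of the queue lengths. -/
theorem Switch.drift_queue_le (S : Switch n Δ) (hm : 0 < m) (hν : IsSaturated ν m) (hε : 0 < ε)
    (x : State n Δ) :
    ∑ i, ∑ j, (x.q i j : ℝ) * ((1 - ε) * ν i j) - ∑ i, ∑ j, (x.q i j : ℝ) * x.service i j
      ≤ S.lostWeight x - ε * m * x.total := by
  have h1 := S.inner_add_le_weight_maxSched x hm hν
  have h2 := hν.mul_total_le x
  have h3 : 0 ≤ m * ‖perp x.qvec‖ := by positivity
  have h4 : ∑ i, ∑ j, (x.q i j : ℝ) * ((1 - ε) * ν i j)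
      = (1 - ε) * inner ℝ x.qvec (vec ν) := by
    rw [inner_qvec_eq]
    simp only [Finset.mul_sum]
    refine Finset.sum_congr rfl fun i _ => Finset.sum_congr rfl fun j _ => ?_
    ring
  rw [h4, x.sum_mul_service]
  unfold Switch.lostWeight Switch.maxWeight
  nlinarith

/-- Drift of the squared distance of the queue lengths to the cone. -/
theorem Switch.drift_perp_le (S : Switch n Δ) (hm : 0 < m) (hν : IsSaturated ν m) (hε : 0 < ε)
    (hε' : ε ≤ m / (4 * ‖vec ν‖)) (x : State n Δ) :
    ∑ i, ∑ j, perp x.qvec (i, j) * ((1 - ε) * ν i j)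
        - ∑ i, ∑ j, perp x.qvec (i, j) * x.service i j
      ≤ S.lostWeight x - 3 / 4 * m * ‖perp x.qvec‖ := by
  have hvec : 0 < ‖vec ν‖ := hm.trans_le hν.le_norm
  have h1 := S.inner_add_le_weight_maxSched x hm hν
  have h2 : ∑ i, ∑ j, par x.qvec (i, j) * x.service i j ≤ ∑ i, ∑ j, par x.qvec (i, j) * ν i j := by
    refine sum_mul_le_of_mem_cone (par_mem _) (fun i => ?_) (fun j => ?_) hν.row_sum hν.col_sum
    · refine le_trans (Finset.sum_le_sum fun j _ => ?_) (x.s.row_sum_le i)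
      exact_mod_cast x.service_le i j
    · refine le_trans (Finset.sum_le_sum fun i _ => ?_) (x.s.col_sum_le j)
      exact_mod_cast x.service_le i j
  have h3 : ∀ A : Fin n → Fin n → ℝ, ∑ i, ∑ j, perp x.qvec (i, j) * A i j
      = ∑ i, ∑ j, (x.q i j : ℝ) * A i j - ∑ i, ∑ j, par x.qvec (i, j) * A i j := by
    intro A
    simp only [← Finset.sum_sub_distrib]
    refine Finset.sum_congr rfl fun i _ => Finset.sum_congr rfl fun j _ => ?_
    simp only [perp, PiLp.sub_apply, State.qvec_apply]
    ring
  have h4 : ∑ i, ∑ j, perp x.qvec (i, j) * ((1 - ε) * ν i j)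
      = ∑ i, ∑ j, perp x.qvec (i, j) * ν i j - ε * inner ℝ (perp x.qvec) (vec ν) := by
    rw [inner_eq_sum]
    simp only [Finset.mul_sum, ← Finset.sum_sub_distrib]
    refine Finset.sum_congr rfl fun i _ => Finset.sum_congr rfl fun j _ => ?_
    rw [vec_apply]
    ring
  -- The heavy-traffic restriction on ε enters here: the missing load costs at most a quarter of the
  -- restoring drift.
  have h5 : -(ε * inner ℝ (perp x.qvec) (vec ν)) ≤ m / 4 * ‖perp x.qvec‖ := by
    have h6 := neg_le_of_abs_le (abs_real_inner_le_norm (perp x.qvec) (vec ν))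
    have h7 : ε * ‖vec ν‖ ≤ m / 4 := by
      rw [le_div_iff₀ (by positivity)] at hε'
      linarith
    nlinarith [mul_le_mul_of_nonneg_right h7 (norm_nonneg (perp x.qvec))]
  have h8 := x.sum_mul_service
  rw [h4, h3, h3 fun i j => (x.service i j : ℝ), h8]
  rw [inner_qvec_eq] at h1
  unfold Switch.lostWeight Switch.maxWeight
  linarith

/-- The drift of a Lyapunov function that bounds the mean total queue length. -/
theorem exists_total_drift (hg : IsHysteresis g) (hm : 0 < m) (hν : IsSaturated ν m)
    (hε : 0 < ε) (S : Switch n Δ) (amax : ℕ) :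
    ∃ (V : State n Δ → ℝ) (b : ℝ), (∀ x, 0 ≤ V x) ∧ 0 ≤ b ∧
      ∀ x, ∃ (k : ℝ) (c : Fin n → Fin n → ℝ),
        (∀ a : Fin n → Fin n → ℕ, (∀ i j, a i j ≤ amax) →
          V (S.step g x a) ≤ k + ∑ i, ∑ j, c i j * (a i j : ℝ)) ∧
        k + ∑ i, ∑ j, c i j * ((1 - ε) * ν i j) + ε * m * x.total ≤ V x + b := by
  have hεm : 0 < ε * m := mul_pos hε hm
  obtain ⟨b, hb, hΨ⟩ := exists_compensator hg n Δ amax hεm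
  obtain ⟨Ψ, hΨ0, hΨ⟩ := hΨ S
  refine ⟨fun x => ‖x.qvec‖ ^ 2 + Ψ x, b + n ^ 2 * (amax + 1) ^ 2,
    fun x => add_nonneg (sq_nonneg _) (hΨ0 x), by positivity, fun x =>
    ⟨‖x.qvec‖ ^ 2 - 2 * ∑ i, ∑ j, (x.q i j : ℝ) * x.service i j + n ^ 2 * (amax + 1) ^ 2
      + (Ψ x + ε * m * S.maxWeight x + b - 2 * S.lostWeight x),
      fun i j => 2 * x.q i j, fun a ha => ?_, ?_⟩⟩
  · have h1 := S.norm_sq_step_sub_le g x ha (p := 0) (fun _ => le_rfl)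
    simp only [sub_zero, State.qvec_apply] at h1
    have h2 := hΨ x a ha
    linarith
  · have h1 := S.drift_queue_le hm hν hε x
    have h2 := mul_le_mul_of_nonneg_left (S.maxWeight_le_total x) hεm.le
    have h3 : ∑ i, ∑ j, 2 * (x.q i j : ℝ) * ((1 - ε) * ν i j)
        = 2 * ∑ i, ∑ j, (x.q i j : ℝ) * ((1 - ε) * ν i j) := by
      simp only [Finset.mul_sum, mul_assoc]
    rw [h3]
    linarith

theorem Switch.HasTraffic.integrable_total (hg : IsHysteresis g) (hm : 0 < m)
    (hν : IsSaturated ν m) (hε : 0 < ε) (hS : S.HasTraffic amax σ ν ε) {π : Measure (State n Δ)}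
    (hπ : S.IsSteadyState g π) : Integrable (fun x => x.total) π := by
  have := hπ.isProbabilityMeasure
  obtain ⟨V, b, hV, hb, hd⟩ := exists_total_drift hg hm hν hε S amax
  have hεm : 0 < ε * m := mul_pos hε hm
  have h := (hS.integral_le_of_drift hπ (f := fun x => ε * m * x.total) (h := fun _ => b) hV
    (fun x => mul_nonneg hεm.le x.total_nonneg) (fun _ => hb) (integrable_const _) hd).1
  exact (integrable_const_mul_iff hεm.ne'.isUnit _).1 h

theorem Switch.HasTraffic.exists_isSteadyState (hg : IsHysteresis g) (hm : 0 < m)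
    (hν : IsSaturated ν m) (hε : 0 < ε) (hS : S.HasTraffic amax σ ν ε) :
    ∃ π, S.IsSteadyState g π := by
  obtain ⟨V, b, hV, hb, hd⟩ := exists_total_drift hg hm hν hε S amax
  have hεm : 0 < ε * m := mul_pos hε hm
  -- Outside this finite set εm times the total exceeds b + 1, so the drift is below -1.
  let F := (State.finite_total_le (n := n) (Δ := Δ) ((b + 1) / (ε * m))).toFinset
  let x₀ : State n Δ := ⟨0, permSchedule 1, 0⟩
  have hdrift := hS.drift_le (g := g) (V := V) (f := fun _ => 1)
    (h := (F : Set (State n Δ)).indicator fun _ => b + 1) hV (fun _ => zero_le_one)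
    (fun x => Set.indicator_nonneg (fun _ _ => by linarith) x) (fun x => ?_)
  · obtain ⟨π, hπ, hinv⟩ := exists_invariant_of_drift (S.transition g) x₀
      (V := fun x => ENNReal.ofReal (V x)) ENNReal.ofReal_ne_top F
      (b := ENNReal.ofReal (b + 1)) ENNReal.ofReal_ne_top fun x => by
        refine le_trans (le_of_eq ?_) ((hdrift x).trans (le_of_eq ?_))
        · simp
        · congr 1
          by_cases hx : x ∈ (F : Set (State n Δ))
          · rw [Set.indicator_of_mem hx, Set.indicator_of_mem hx]
          · rw [Set.indicator_of_notMem hx, Set.indicator_of_notMem hx, ENNReal.ofReal_zero]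
    exact ⟨π, hπ, hinv⟩
  · obtain ⟨k, c, h1, h2⟩ := hd x
    refine ⟨k, c, h1, ?_⟩
    by_cases hx : x ∈ (F : Set (State n Δ))
    · rw [Set.indicator_of_mem hx]
      nlinarith [mul_nonneg hεm.le x.total_nonneg]
    · rw [Set.indicator_of_notMem hx]
      have h3 : (b + 1) / (ε * m) < x.total := by
        by_contra hcon
        exact hx (by simpa [F] using not_lt.1 hcon)
      rw [div_lt_iff₀ hεm] at h3
      linarith

theorem integrable_of_le_total {π : Measure (State n Δ)} (h : Integrable (fun x => x.total) π)
    {f : State n Δ → ℝ} (hf0 : ∀ x, 0 ≤ f x) (hf : ∀ x, f x ≤ ‖x.qvec‖) : Integrable f π := by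
  refine h.mono' Measurable.of_discrete.aestronglyMeasurable (ae_of_all _ fun x => ?_)
  rw [Real.norm_of_nonneg (hf0 x)]
  exact (hf x).trans x.norm_qvec_le_total

/-- Weak state space collapse, with a constant that depends on the rate matrix only through its
smallest entry. -/
theorem exists_weak_state_space_collapse (hg : IsHysteresis g) (n Δ amax : ℕ) (σ : ℝ)
    (hm : 0 < m) {θ : ℝ} (hθ : 0 < θ) (hθ' : θ < 1 / 2) :
    ∃ M : ℝ, 0 ≤ M ∧ ∀ ν : Fin n → Fin n → ℝ, IsSaturated ν m →
      ∀ ε : ℝ, 0 < ε → ε ≤ m / (4 * ‖vec ν‖) →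
      ∀ S : Switch n Δ, S.HasTraffic amax σ ν ε → ∀ π, S.IsSteadyState g π →
        ∫ x, ‖perp x.qvec‖ ∂π ≤ θ * ∫ x, ‖par x.qvec‖ ∂π + M := by
  -- Since W* ≤ n²(‖q_∥‖ + ‖q_⊥‖), this makes η W* at most mθ‖q_∥‖ + mθ‖q_⊥‖. With θ < 1/2 the
  -- second term is at most (m/2)‖q_⊥‖, leaving m of the restoring coefficient 3m/2.
  set η : ℝ := m * θ / (n ^ 2 + 1) with hη
  have hη0 : 0 < η := by positivity
  have hηn : η * n ^ 2 ≤ m * θ := by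
    rw [hη, div_mul_eq_mul_div, div_le_iff₀ (by positivity)]
    nlinarith [mul_pos hm hθ]
  obtain ⟨b, hb, hΨ⟩ := exists_compensator hg n Δ amax hη0
  refine ⟨(b + n ^ 2 * (amax + 1) ^ 2) / m, by positivity, fun ν hν ε hε hε' S hS π hπ => ?_⟩
  have := hπ.isProbabilityMeasure
  obtain ⟨Ψ, hΨ0, hΨ⟩ := hΨ S
  have hT := hS.integrable_total hg hm hν hε hπ
  have hpar : Integrable (fun x : State n Δ => ‖par x.qvec‖) π :=
    integrable_of_le_total hT (fun x => norm_nonneg _) fun x => norm_par_le_norm _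
  have key := (hS.integral_le_of_drift hπ (V := fun x => ‖perp x.qvec‖ ^ 2 + Ψ x)
    (f := fun x => m * ‖perp x.qvec‖)
    (h := fun x => m * θ * ‖par x.qvec‖ + (b + n ^ 2 * (amax + 1) ^ 2))
    (fun x => add_nonneg (sq_nonneg _) (hΨ0 x)) (fun x => by positivity) (fun x => by positivity)
    ((hpar.const_mul _).add (integrable_const _)) fun x =>
    ⟨‖perp x.qvec‖ ^ 2 - 2 * ∑ i, ∑ j, perp x.qvec (i, j) * x.service i j
      + n ^ 2 * (amax + 1) ^ 2 + (Ψ x + η * S.maxWeight x + b - 2 * S.lostWeight x),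
      fun i j => 2 * perp x.qvec (i, j), fun a ha => ?_, ?_⟩).2
  · rw [integral_add (hpar.const_mul _) (integrable_const _), integral_const_mul,
      integral_const_mul, integral_const] at key
    simp only [probReal_univ, one_smul] at key
    have h1 : θ * ∫ x, ‖par x.qvec‖ ∂π + (b + n ^ 2 * (amax + 1) ^ 2) / m
        = (m * θ * ∫ x, ‖par x.qvec‖ ∂π + (b + n ^ 2 * (amax + 1) ^ 2)) / m := by
      field_simp
    rw [h1, le_div_iff₀ hm]
    linarith
  · have h1 := S.norm_sq_step_sub_le g x ha (p := par x.qvec) (par_nonneg _)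
    -- The new distance to the cone is at most the distance to the old projection, so the projection
    -- need not be followed through the step.
    have h2 := norm_perp_le (S.step g x a).qvec _ (par_mem x.qvec)
    have h3 := pow_le_pow_left₀ (norm_nonneg _) h2 2
    have h4 := hΨ x a ha
    change _ ≤ ‖perp x.qvec‖ ^ 2 - 2 * ∑ i, ∑ j, perp x.qvec (i, j) * x.service i j
      + n ^ 2 * (amax + 1) ^ 2 + ∑ i, ∑ j, 2 * perp x.qvec (i, j) * (a i j : ℝ) at h1
    linarith
  · have h1 := S.drift_perp_le hm hν hε hε' x
    have h2 : ∑ i, ∑ j, 2 * perp x.qvec (i, j) * ((1 - ε) * ν i j)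
        = 2 * ∑ i, ∑ j, perp x.qvec (i, j) * ((1 - ε) * ν i j) := by
      simp only [Finset.mul_sum, mul_assoc]
    have h3 : (S.maxWeight x : ℝ) ≤ n ^ 2 * (‖par x.qvec‖ + ‖perp x.qvec‖) :=
      (S.maxWeight_le_total x).trans (x.total_le_norm_qvec.trans
        (mul_le_mul_of_nonneg_left (norm_le_par_add_perp _) (by positivity)))
    have h4 : η * S.maxWeight x ≤ m * θ * ‖par x.qvec‖ + m / 2 * ‖perp x.qvec‖ := by
      have h5 := mul_le_mul_of_nonneg_left h3 hη0.le
      have h6 := mul_le_mul_of_nonneg_right hηn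
        (add_nonneg (norm_nonneg (par x.qvec)) (norm_nonneg (perp x.qvec)))
      have h7 : m * θ * ‖perp x.qvec‖ ≤ m / 2 * ‖perp x.qvec‖ := by
        gcongr; nlinarith
      linarith
    rw [h2]
    linarith

end Bounds

/-! ### Heavy traffic: divergence of the mean queue length and the ratio limit -/

section HeavyTraffic

variable {S : Switch n Δ} {g : ℝ → ℝ} {amax : ℕ} {σ ε m : ℝ} {ν : Fin n → Fin n → ℝ}

/-- The total length of the queues that are not scheduled. -/
def State.unscheduled (x : State n Δ) : ℝ := ∑ i, ∑ j, (x.q i j : ℝ) * (1 - x.s.1 i j)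

theorem State.unscheduled_nonneg (x : State n Δ) : 0 ≤ x.unscheduled := by
  refine Finset.sum_nonneg fun i _ => Finset.sum_nonneg fun j _ => ?_
  have : (x.s.1 i j : ℝ) ≤ 1 := by exact_mod_cast x.s.le_one i j
  exact mul_nonneg (Nat.cast_nonneg _) (by linarith)

theorem State.unscheduled_le_total (x : State n Δ) : x.unscheduled ≤ x.total := by
  refine Finset.sum_le_sum fun i _ => Finset.sum_le_sum fun j _ => ?_
  have : (0 : ℝ) ≤ x.s.1 i j := Nat.cast_nonneg _
  exact mul_le_of_le_one_right (Nat.cast_nonneg _) (by linarith)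

theorem Schedule.exists_eq_zero (hn : 2 ≤ n) (s : Schedule n) : ∃ i j, s.1 i j = 0 := by
  by_contra! h
  have h1 := s.2.2 ⟨0, by omega⟩
  have h2 : ∑ _j : Fin n, 1 ≤ ∑ j, s.1 ⟨0, by omega⟩ j :=
    Finset.sum_le_sum fun j _ => Nat.one_le_iff_ne_zero.2 (h _ _)
  simp at h2
  omega

theorem integrable_indicator_one {π : Measure (State n Δ)} [IsProbabilityMeasure π]
    (s : Set (State n Δ)) : Integrable (s.indicator fun _ => (1 : ℝ)) π :=
  (integrable_const 1).indicator MeasurableSet.of_discrete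

theorem indicator_one_nonneg (s : Set (State n Δ)) (x : State n Δ) :
    0 ≤ s.indicator (fun _ => (1 : ℝ)) x :=
  Set.indicator_nonneg (fun _ _ => zero_le_one) x

theorem Switch.add_sub_service_le_step (S : Switch n Δ) (g : ℝ → ℝ) (x : State n Δ)
    (a : Fin n → Fin n → ℕ) (i j : Fin n) :
    (x.q i j : ℝ) + a i j - x.service i j ≤ (S.step g x a).q i j := by
  have h : x.q i j + a i j ≤ (S.step g x a).q i j + x.service i j := by
    simp only [Switch.step, State.service]
    omega
  rw [sub_le_iff_le_add]
  exact_mod_cast h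

/-- In steady state the switch is being reconfigured for at most a fraction `ε` of the time. -/
theorem Switch.HasTraffic.integral_reconfiguring_le (hg : IsHysteresis g) (hm : 0 < m)
    (hν : IsSaturated ν m) (hε : 0 < ε) (hS : S.HasTraffic amax σ ν ε)
    {π : Measure (State n Δ)} (hπ : S.IsSteadyState g π) :
    ∫ x, {x : State n Δ | (x.r : ℕ) ≠ 0}.indicator (fun _ => (1 : ℝ)) x ∂π ≤ ε := by
  have := hπ.isProbabilityMeasure
  have hT := hS.integrable_total hg hm hν hε hπ
  let i₀ : Fin n := ⟨0, hν.pos_dim⟩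
  have hrow : ∀ x : State n Δ, ∑ j, (x.q i₀ j : ℝ) ≤ x.total := fun x =>
    Finset.single_le_sum (f := fun i => ∑ j, (x.q i j : ℝ))
      (fun _ _ => Finset.sum_nonneg fun _ _ => Nat.cast_nonneg _) (Finset.mem_univ i₀)
  have hrow0 : ∀ x : State n Δ, 0 ≤ ∑ j, (x.q i₀ j : ℝ) := fun x =>
    Finset.sum_nonneg fun _ _ => Nat.cast_nonneg _
  -- One row receives 1 - ε on average and is offered at most one service per slot, none while r ≠
  -- 0. Stationarity then leaves at most ε for the event r ≠ 0.
  have key := hS.integral_le_of_reverse_drift hπ (V := fun x => ∑ j, (x.q i₀ j : ℝ))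
    (f := {x : State n Δ | (x.r : ℕ) ≠ 0}.indicator fun _ => (1 : ℝ)) (h := fun _ => ε) hrow0
    (hT.mono' Measurable.of_discrete.aestronglyMeasurable
      (ae_of_all _ fun x => by rw [Real.norm_of_nonneg (hrow0 x)]; exact hrow x))
    (indicator_one_nonneg _) (fun _ => hε.le) (integrable_const _) fun x =>
    ⟨∑ j, (x.q i₀ j : ℝ) - ∑ j, (x.service i₀ j : ℝ), fun i _ => if i = i₀ then 1 else 0,
      fun a _ => ?_, ?_⟩
  · simpa using key
  · have h1 : ∑ i, ∑ j, (if i = i₀ then (1 : ℝ) else 0) * (a i j : ℝ) = ∑ j, (a i₀ j : ℝ) := by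
      rw [Finset.sum_comm]; simp
    rw [h1, ← Finset.sum_sub_distrib, ← Finset.sum_add_distrib]
    refine Finset.sum_le_sum fun j _ => le_trans (le_of_eq ?_) (S.add_sub_service_le_step g x a i₀ j)
    ring
  · have h1 : ∑ i, ∑ j, (if i = i₀ then (1 : ℝ) else 0) * ((1 - ε) * ν i j) = 1 - ε := by
      rw [Finset.sum_comm]
      simp [← Finset.mul_sum, hν.row_sum]
    rw [h1]
    by_cases hr : (x.r : ℕ) = 0
    · have h2 : ∑ j, (x.service i₀ j : ℝ) ≤ 1 := by
        refine le_trans (Finset.sum_le_sum fun j _ => ?_) (x.s.row_sum_le i₀)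
        exact_mod_cast x.service_le i₀ j
      rw [Set.indicator_of_notMem (by simpa using hr)]
      linarith
    · have h2 : ∑ j, (x.service i₀ j : ℝ) = 0 := by simp [State.service, hr]
      rw [Set.indicator_of_mem (by simpa using hr), h2]
      linarith

/-- In steady state reconfigurations begin at most as often as the switch is being
reconfigured. -/
theorem Switch.HasTraffic.integral_reconfigures_le (hΔ : 0 < Δ) (hS : S.HasTraffic amax σ ν ε)
    {π : Measure (State n Δ)} (hπ : S.IsSteadyState g π) :
    ∫ x, {x | S.Reconfigures g x}.indicator (fun _ => (1 : ℝ)) x ∂π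
      ≤ ∫ x, {x : State n Δ | (x.r : ℕ) ≠ 0}.indicator (fun _ => (1 : ℝ)) x ∂π := by
  have := hπ.isProbabilityMeasure
  -- Every start sets r = Δ > 0 in the next slot, so the indicator of r ≠ 0 after one step dominates
  -- the indicator of a start.
  refine (hS.integral_le_of_reverse_drift hπ
    (V := {x : State n Δ | (x.r : ℕ) ≠ 0}.indicator fun _ => (1 : ℝ)) (indicator_one_nonneg _)
    (integrable_indicator_one _) (indicator_one_nonneg _) (indicator_one_nonneg _)
    (integrable_indicator_one _) fun x =>
    ⟨{x | S.Reconfigures g x}.indicator (fun _ => (1 : ℝ)) x, 0, fun a _ => ?_, ?_⟩)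
  · by_cases h : S.Reconfigures g x
    · have h1 := S.step_r_of_reconfigures g x a h
      rw [Set.indicator_of_mem (by exact h), Set.indicator_of_mem
        (by simp only [Set.mem_ofPred_eq, h1]; omega)]
      simp
    · rw [Set.indicator_of_notMem (by exact h)]
      simpa using indicator_one_nonneg _ _
  · simp [add_comm]

/-- In steady state the unscheduled queues are rarely short: as long as the schedule is kept they
grow at a rate that does not depend on `ε`. -/
theorem Switch.HasTraffic.integral_unscheduled_lt_le (hm : 0 < m) (hν : IsSaturated ν m)
    (hn : 2 ≤ n) (hε : ε ≤ 1 / 2) (hS : S.HasTraffic amax σ ν ε)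
    {π : Measure (State n Δ)} (hπ : S.IsSteadyState g π) (L : ℕ) :
    m / (2 * (amax + 1)) * ∫ x, {x : State n Δ | x.unscheduled < L}.indicator (fun _ => (1 : ℝ)) x ∂π
      ≤ (L + m / (2 * (amax + 1)))
        * ∫ x, {x | S.Reconfigures g x}.indicator (fun _ => (1 : ℝ)) x ∂π := by
  have := hπ.isProbabilityMeasure
  set c₀ : ℝ := m / (2 * (amax + 1)) with hc₀
  have hc₀0 : 0 ≤ c₀ := by positivity
  have hL : (0 : ℝ) ≤ L := Nat.cast_nonneg _
  rw [← integral_const_mul, ← integral_const_mul]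
  have hφ0 : ∀ x : State n Δ, 0 ≤ min x.unscheduled (L : ℝ) := fun x =>
    le_min x.unscheduled_nonneg hL
  refine (hS.integral_le_of_reverse_drift hπ (V := fun x => min x.unscheduled (L : ℝ)) hφ0
    ((integrable_const (L : ℝ)).mono' Measurable.of_discrete.aestronglyMeasurable
      (ae_of_all _ fun x => by rw [Real.norm_of_nonneg (hφ0 x)]; exact min_le_right _ _))
    (fun x => mul_nonneg hc₀0 (indicator_one_nonneg _ x))
    (fun x => mul_nonneg (add_nonneg hL hc₀0) (indicator_one_nonneg _ x))
    ((integrable_indicator_one _).const_mul _) fun x => ?_)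
  have hind : {x : State n Δ | x.unscheduled < L}.indicator (fun _ => (1 : ℝ)) x ≤ 1 :=
    Set.indicator_le_self' (fun _ _ => zero_le_one) x
  by_cases h : S.Reconfigures g x
  -- A change of schedule can wipe out the capped potential; the loss is at most L, plus c₀ for the
  -- indicator.
  · refine ⟨0, 0, fun a _ => by simpa using hφ0 _, ?_⟩
    rw [Set.indicator_of_mem (s := {x | S.Reconfigures g x}) h]
    simp only [Pi.zero_apply, zero_mul, Finset.sum_const_zero, add_zero, zero_add, mul_one]
    have := min_le_right x.unscheduled (L : ℝ)
    nlinarith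
  · rw [Set.indicator_of_notMem (s := {x | S.Reconfigures g x}) h]
    have hstep : ∀ a, x.unscheduled + ∑ i, ∑ j, (a i j : ℝ) * (1 - x.s.1 i j)
        ≤ (S.step g x a).unscheduled := by
      intro a
      unfold State.unscheduled
      rw [S.step_s_of_not_reconfigures g x a h, ← Finset.sum_add_distrib]
      refine Finset.sum_le_sum fun i _ => ?_
      rw [← Finset.sum_add_distrib]
      refine Finset.sum_le_sum fun j _ => ?_
      have h1 := S.add_sub_service_le_step g x a i j
      rcases Nat.le_one_iff_eq_zero_or_eq_one.1 (x.s.le_one i j) with h2 | h2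
      · have h3 : x.service i j = 0 := Nat.le_zero.1 (h2 ▸ x.service_le i j)
        rw [h3] at h1
        rw [h2]
        push_cast at h1 ⊢
        linarith
      · rw [h2]; simp
    have hs0 : ∀ i j, (0 : ℝ) ≤ 1 - x.s.1 i j := fun i j => by
      rw [sub_nonneg]; exact_mod_cast x.s.le_one i j
    by_cases hU : x.unscheduled < L
    · obtain ⟨i₀, j₀, hij⟩ := x.s.exists_eq_zero hn
      -- One unserved queue suffices for growth. Scaling its arrivals by 1/(amax + 1) keeps the
      -- increment below 1, and an integer less than L stays at most L after adding 1, so the cap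
      -- does not interfere.
      refine ⟨x.unscheduled, fun i j => if i = i₀ then (if j = j₀ then 1 / (amax + 1) else 0) else 0,
        fun a ha => ?_, ?_⟩
      · have h1 : ∑ i, ∑ j, (if i = i₀ then (if j = j₀ then 1 / (amax + 1 : ℝ) else 0) else 0)
            * (a i j : ℝ) = (a i₀ j₀ : ℝ) / (amax + 1) := by
          rw [Finset.sum_eq_single i₀ (by intro b _ hb; simp [hb]) (by simp),
            Finset.sum_eq_single j₀ (by intro b _ hb; simp [hb]) (by simp)]
          simp [div_eq_inv_mul]
        rw [h1]
        have h2 : (a i₀ j₀ : ℝ) ≤ ∑ i, ∑ j, (a i j : ℝ) * (1 - x.s.1 i j) := by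
          have h3 : ∀ i, 0 ≤ ∑ j, (a i j : ℝ) * (1 - x.s.1 i j) := fun i =>
            Finset.sum_nonneg fun j _ => mul_nonneg (Nat.cast_nonneg _) (hs0 i j)
          refine le_trans ?_ (Finset.single_le_sum (fun i _ => h3 i) (Finset.mem_univ i₀))
          refine le_trans ?_ (Finset.single_le_sum (fun j _ => mul_nonneg (Nat.cast_nonneg _)
            (hs0 i₀ j)) (Finset.mem_univ j₀))
          simp [hij]
        have hpos : (0 : ℝ) < amax + 1 := by positivity
        have h4 : (a i₀ j₀ : ℝ) / (amax + 1) ≤ a i₀ j₀ :=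
          div_le_self (Nat.cast_nonneg _) (by simp)
        have h5 : (a i₀ j₀ : ℝ) / (amax + 1) ≤ 1 := by
          rw [div_le_one hpos]
          have : (a i₀ j₀ : ℝ) ≤ amax := by exact_mod_cast ha i₀ j₀
          linarith
        refine le_min ((add_le_add_right (h4.trans h2) _).trans (hstep a)) ?_
        obtain ⟨u, hu⟩ : ∃ u : ℕ, x.unscheduled = u := by
          refine ⟨∑ i, ∑ j, x.q i j * (1 - x.s.1 i j), ?_⟩
          unfold State.unscheduled
          push_cast
          refine Finset.sum_congr rfl fun i _ => Finset.sum_congr rfl fun j _ => ?_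
          rw [Nat.cast_sub (x.s.le_one i j)]
          simp
        rw [hu] at hU ⊢
        have : (u : ℝ) + 1 ≤ L := by exact_mod_cast Nat.succ_le_of_lt (by exact_mod_cast hU)
        linarith
      · have h1 : ∑ i, ∑ j, (if i = i₀ then (if j = j₀ then 1 / (amax + 1 : ℝ) else 0) else 0)
            * ((1 - ε) * ν i j) = (1 - ε) * ν i₀ j₀ / (amax + 1) := by
          rw [Finset.sum_eq_single i₀ (by intro b _ hb; simp [hb]) (by simp),
            Finset.sum_eq_single j₀ (by intro b _ hb; simp [hb]) (by simp)]
          simp [div_eq_inv_mul]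
        rw [h1, Set.indicator_of_mem (by exact hU)]
        have h2 : c₀ ≤ (1 - ε) * ν i₀ j₀ / (amax + 1) := by
          rw [hc₀, mul_comm (2 : ℝ), ← div_div, div_right_comm]
          gcongr
          nlinarith [hν.le i₀ j₀]
        have h3 := min_le_left x.unscheduled (L : ℝ)
        linarith
    · refine ⟨L, 0, fun a _ => ?_, ?_⟩
      · have h1 : 0 ≤ ∑ i, ∑ j, (a i j : ℝ) * (1 - x.s.1 i j) :=
          Finset.sum_nonneg fun i _ => Finset.sum_nonneg fun j _ =>
            mul_nonneg (Nat.cast_nonneg _) (hs0 i j)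
        have h2 := hstep a
        simp only [Pi.zero_apply, zero_mul, Finset.sum_const_zero, add_zero]
        exact le_min (by linarith) le_rfl
      · rw [Set.indicator_of_notMem (by exact hU)]
        simp

/-- A lower bound of the mean queue length that tends to `L` as `ε → 0`. -/
theorem Switch.HasTraffic.le_integral_norm (hΔ : 0 < Δ) (hg : IsHysteresis g) (hm : 0 < m)
    (hν : IsSaturated ν m) (hn : 2 ≤ n) (hε : 0 < ε) (hε' : ε ≤ 1 / 2)
    (hS : S.HasTraffic amax σ ν ε) {π : Measure (State n Δ)} (hπ : S.IsSteadyState g π) (L : ℕ) :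
    L - L * ((L + m / (2 * (amax + 1))) / (m / (2 * (amax + 1)))) * ε
      ≤ n ^ 2 * ∫ x, ‖x.qvec‖ ∂π := by
  have := hπ.isProbabilityMeasure
  have h1 := hS.integral_unscheduled_lt_le (g := g) hm hν hn hε' hπ L
  have h2 := (hS.integral_reconfigures_le (g := g) hΔ hπ).trans
    (hS.integral_reconfiguring_le hg hm hν hε hπ)
  have hT := hS.integrable_total hg hm hν hε hπ
  have hq : Integrable (fun x : State n Δ => ‖x.qvec‖) π :=
    integrable_of_le_total hT (fun x => norm_nonneg _) fun x => le_rfl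
  set c₀ : ℝ := m / (2 * (amax + 1))
  have hc₀ : 0 < c₀ := by positivity
  have hL : (0 : ℝ) ≤ L := Nat.cast_nonneg _
  set I := {x : State n Δ | x.unscheduled < L}.indicator (fun _ => (1 : ℝ))
  have h3 : ∫ x, I x ∂π ≤ (L + c₀) / c₀ * ε := by
    rw [div_mul_eq_mul_div, le_div_iff₀ hc₀, mul_comm]
    exact h1.trans (mul_le_mul_of_nonneg_left h2 (by positivity))
  -- Pointwise, either the unscheduled queues, and hence n²‖q‖, reach L, or the indicator supplies
  -- L.
  have h4 : ∫ _, (L : ℝ) ∂π ≤ ∫ x, (n ^ 2 * ‖x.qvec‖ + L * I x) ∂π := by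
    refine integral_mono (integrable_const _)
      ((hq.const_mul _).add ((integrable_indicator_one _).const_mul _)) fun x => ?_
    have h5 := x.unscheduled_nonneg
    have h6 := x.unscheduled_le_total.trans x.total_le_norm_qvec
    by_cases hx : x.unscheduled < L
    · simp only [I]
      rw [Set.indicator_of_mem (by exact hx)]
      linarith
    · simp only [I]
      rw [Set.indicator_of_notMem (by exact hx)]
      linarith
  rw [integral_add (hq.const_mul _) ((integrable_indicator_one _).const_mul _),
    integral_const_mul, integral_const_mul, integral_const] at h4
  simp only [probReal_univ, one_smul] at h4
  have h7 := mul_le_mul_of_nonneg_left h3 hL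
  linarith

/-- If `n = 1`, the cone consists of all nonnegative vectors. -/
theorem State.perp_qvec_eq_zero (x : State 1 Δ) : perp x.qvec = 0 := by
  have hx : x.qvec ∈ cone 1 := by
    refine ⟨fun i => x.q i 0, 0, fun i => Nat.cast_nonneg _, fun _ => le_rfl, fun i j => ?_⟩
    rw [Subsingleton.elim j 0]
    simp
  have h := norm_perp_le x.qvec _ hx
  simpa using h

theorem tendsto_integral_norm_atTop (hΔ : 0 < Δ) (hg : IsHysteresis g) (hm : 0 < m)
    (hν : IsSaturated ν m) (hn : 2 ≤ n) {S : ℝ → Switch n Δ} {π : ℝ → Measure (State n Δ)}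
    (h : ∀ ε : ℝ, 0 < ε → ε < 1 → (S ε).HasTraffic amax σ ν ε ∧ (S ε).IsSteadyState g (π ε)) :
    Tendsto (fun ε => ∫ x, ‖x.qvec‖ ∂(π ε)) (𝓝[>] 0) atTop := by
  have hn2 : (0 : ℝ) < n ^ 2 := by positivity
  suffices hs : Tendsto (fun ε => (n : ℝ) ^ 2 * ∫ x, ‖x.qvec‖ ∂(π ε)) (𝓝[>] 0) atTop from
    (tendsto_const_mul_atTop_of_pos hn2).1 hs
  refine tendsto_atTop.2 fun B => ?_
  obtain ⟨L, hL⟩ := exists_nat_gt B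
  set D : ℝ := L * ((L + m / (2 * (amax + 1))) / (m / (2 * (amax + 1))))
  have hlim : Tendsto (fun ε : ℝ => (L : ℝ) - D * ε) (𝓝[>] 0) (𝓝 (L - D * 0)) :=
    (Continuous.tendsto (by fun_prop) 0).mono_left nhdsWithin_le_nhds
  rw [mul_zero, sub_zero] at hlim
  filter_upwards [hlim.eventually (lt_mem_nhds hL), Ioc_mem_nhdsGT (one_half_pos (α := ℝ))]
    with ε h1 h2
  obtain ⟨hS, hπ⟩ := h ε h2.1 (h2.2.trans_lt one_half_lt_one)
  exact h1.le.trans (hS.le_integral_norm hΔ hg hm hν hn h2.1 h2.2 hπ L)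

theorem tendsto_integral_perp_div (hΔ : 0 < Δ) (hg : IsHysteresis g) (hm : 0 < m)
    (hν : IsSaturated ν m) (hn : 2 ≤ n) {S : ℝ → Switch n Δ} {π : ℝ → Measure (State n Δ)}
    (h : ∀ ε : ℝ, 0 < ε → ε < 1 → (S ε).HasTraffic amax σ ν ε ∧ (S ε).IsSteadyState g (π ε)) :
    Tendsto (fun ε => (∫ x, ‖perp x.qvec‖ ∂(π ε)) / ∫ x, ‖x.qvec‖ ∂(π ε)) (𝓝[>] 0) (𝓝 0) := by
  have hinf := tendsto_integral_norm_atTop hΔ hg hm hν hn h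
  refine tendsto_order.2 ⟨fun b hb => Eventually.of_forall fun ε => hb.trans_le (by positivity),
    fun b hb => ?_⟩
  -- Half of b absorbs the θ-term, and the other half absorbs M once the mean norm exceeds 2M/b.
  set θ : ℝ := min (b / 2) (1 / 4)
  have hθ : 0 < θ := lt_min (by positivity) (by norm_num)
  obtain ⟨M, hM0, hM⟩ := exists_weak_state_space_collapse hg n Δ amax σ hm hθ
    ((min_le_right _ _).trans_lt (by norm_num))
  have hvec : 0 < ‖vec ν‖ := hm.trans_le hν.le_norm
  filter_upwards [hinf.eventually_gt_atTop (2 * M / b), hinf.eventually_gt_atTop 0,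
    Ioc_mem_nhdsGT (show 0 < m / (4 * ‖vec ν‖) by positivity)] with ε h1 hpos h2
  obtain ⟨hS, hπ⟩ := h ε h2.1 (hν.lt_one hm h2.2)
  have hT := hS.integrable_total hg hm hν h2.1 hπ
  have h3 := hM ν hν ε h2.1 h2.2 (S ε) hS (π ε) hπ
  have h4 : ∫ x, ‖par x.qvec‖ ∂(π ε) ≤ ∫ x, ‖x.qvec‖ ∂(π ε) :=
    integral_mono (integrable_of_le_total hT (fun x => norm_nonneg _) fun x => norm_par_le_norm _)
      (integrable_of_le_total hT (fun x => norm_nonneg _) fun x => le_rfl)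
      fun x => norm_par_le_norm _
  rw [div_lt_iff₀ hb] at h1
  rw [div_lt_iff₀ hpos]
  have h5 := mul_le_mul_of_nonneg_left h4 hθ.le
  have h6 : θ * ∫ x, ‖x.qvec‖ ∂(π ε) ≤ b / 2 * ∫ x, ‖x.qvec‖ ∂(π ε) :=
    mul_le_mul_of_nonneg_right (min_le_left _ _) hpos.le
  linarith

end HeavyTraffic

end AdaptiveMaxWeight

end

theorem theorem1 (n Δ : ℕ) (hΔ : 0 < Δ) (g : ℝ → ℝ) (hg : AdaptiveMaxWeight.IsHysteresis g)
    (amax : ℕ) (σ m : ℝ) (hm : 0 < m) :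
    -- steady states exist, and their mean queue lengths are finite
    (∀ ν : Fin n → Fin n → ℝ, AdaptiveMaxWeight.IsSaturated ν m →
      ∀ ε : ℝ, 0 < ε → ε < 1 →
      ∀ S : AdaptiveMaxWeight.Switch n Δ, S.HasTraffic amax σ ν ε →
        (∃ π, S.IsSteadyState g π) ∧
        ∀ π, S.IsSteadyState g π → Integrable (fun x => ‖x.qvec‖) π) ∧
    -- weak state space collapse, with a constant that does not depend on `ε`
    (∀ θ : ℝ, 0 < θ → θ < 1 / 2 → ∃ M : ℝ,
      ∀ ν : Fin n → Fin n → ℝ, AdaptiveMaxWeight.IsSaturated ν m →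
      ∀ ε : ℝ, 0 < ε → ε ≤ m / (4 * ‖AdaptiveMaxWeight.vec ν‖) →
      ∀ S : AdaptiveMaxWeight.Switch n Δ, S.HasTraffic amax σ ν ε →
      ∀ π, S.IsSteadyState g π →
        Integrable (fun x => ‖AdaptiveMaxWeight.perp x.qvec‖
          - θ * ‖AdaptiveMaxWeight.par x.qvec‖) π ∧
        ∫ x, (‖AdaptiveMaxWeight.perp x.qvec‖
          - θ * ‖AdaptiveMaxWeight.par x.qvec‖) ∂π ≤ M) ∧
    -- in heavy traffic, the perpendicular component is negligible in the mean
    (∀ ν : Fin n → Fin n → ℝ, AdaptiveMaxWeight.IsSaturated ν m →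
      ∀ (S : ℝ → AdaptiveMaxWeight.Switch n Δ)
        (π : ℝ → Measure (AdaptiveMaxWeight.State n Δ)),
      (∀ ε : ℝ, 0 < ε → ε < 1 → (S ε).HasTraffic amax σ ν ε ∧ (S ε).IsSteadyState g (π ε)) →
        (2 ≤ n → Tendsto (fun ε => ∫ x, ‖x.qvec‖ ∂(π ε)) (𝓝[>] 0) atTop) ∧
        Tendsto (fun ε => (∫ x, ‖AdaptiveMaxWeight.perp x.qvec‖ ∂(π ε))
          / ∫ x, ‖x.qvec‖ ∂(π ε)) (𝓝[>] 0) (𝓝 0)) := by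
  open AdaptiveMaxWeight in
  refine ⟨fun ν hν ε hε _ S hS => ⟨hS.exists_isSteadyState hg hm hν hε, fun π hπ => ?_⟩,
    fun θ hθ hθ' => ?_, fun ν hν S π h => ⟨fun hn => ?_, ?_⟩⟩
  · exact integrable_of_le_total (hS.integrable_total hg hm hν hε hπ) (fun x => norm_nonneg _)
      fun x => le_rfl
  · obtain ⟨M, _, hM⟩ := exists_weak_state_space_collapse hg n Δ amax σ hm hθ hθ'
    refine ⟨M, fun ν hν ε hε hε' S hS π hπ => ?_⟩
    have hT := hS.integrable_total hg hm hν hε hπ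
    have hperp : Integrable (fun x : State n Δ => ‖perp x.qvec‖) π :=
      integrable_of_le_total hT (fun x => norm_nonneg _) fun x => norm_perp_le_norm _
    have hpar : Integrable (fun x : State n Δ => θ * ‖par x.qvec‖) π :=
      (integrable_of_le_total hT (fun x => norm_nonneg _) fun x => norm_par_le_norm _).const_mul θ
    refine ⟨hperp.sub hpar, ?_⟩
    rw [integral_sub hperp hpar, integral_const_mul]
    have := hM ν hν ε hε hε' S hS π hπ
    linarith
  · exact tendsto_integral_norm_atTop hΔ hg hm hν hn h
  · rcases Nat.lt_or_ge n 2 with hn | hn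
    · obtain rfl : n = 1 := by have := hν.pos_dim; omega
      -- The numerator vanishes identically, and the convention 0/0 = 0 covers a zero denominator.
      simp [State.perp_qvec_eq_zero]
    · exact tendsto_integral_perp_div hΔ hg hm hν hn h
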